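/- Let $a<b$, $n_0,n_1,n_2,n_{BC}\in\mathbb N$, $n_{\mathbf x}=n_0+n_1+n_2$, $n_S=n_1+2n_2$, and write $L_2^n=L_2([a,b];\mathbb R^n)$ and $W_k^n$ for the space of $u\in L_2^n$ with weak derivatives $\partial_s^l u\in L_2^n$, $l\le k$. For $\mathbf x=\mathrm{col}(\mathbf x_0,\mathbf x_1,\mathbf x_2)\in W^n:=W_0^{n_0}\times W_1^{n_1}\times W_2^{n_2}$ put $$\mathbf x_c=\mathrm{col}(\mathbf x_1,\mathbf x_2,\partial_s\mathbf x_2),\quad \mathbf x_D=\mathrm{col}(\mathbf x_0,\mathbf x_1,\mathbf x_2,\partial_s\mathbf x_1,\partial_s\mathbf x_2,\partial_s^2\mathbf x_2),\quad \mathcal D\mathbf x=\mathrm{col}(\mathbf x_0,\partial_s\mathbf x_1,\partial_s^2\mathbf x_2),$$ with $\mathbf x_c$ identified with its continuous representative. Let $B\in\mathbb R^{n_{BC}\times 2n_S}$, let $B_I:[a,b]\to\mathbb R^{n_{BC}\times(n_{\mathbf x}+n_S)}$ be square integrable, let $A_0:[a,b]\to\mathbb R^{n_{\mathbf x}\times(n_{\mathbf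 x}+n_S)}$ be measurable and essentially bounded, and let $A_1,A_2:[a,b]^2\to\mathbb R^{n_{\mathbf x}\times(n_{\mathbf x}+n_S)}$ be square integrable. Let $$X=\Big\{\mathbf x\in W^n:\ B\begin{bmatrix}\mathbf x_c(a)\\ \mathbf x_c(b)\end{bmatrix}=\int_a^b B_I(s)\mathbf x_D(s)\,ds\Big\}.$$ **The PDE.** $\mathbf x:[0,\infty)\to L_2^{n_{\mathbf x}}$ satisfies the PDE with initial condition $\mathbf x^0$ if $\mathbf x(t)\in X$ for all $t\ge0$, $\mathbf x$ is differentiable with respect to the $L_2$-norm at almost every $t\ge 0$, $\mathbf x(0)=\mathbf x^0$, and for almost every $t\ge0$ $$\dot{\mathbf x}(t,s)=A_0(s)\mathbf x_D(t,s)+\int_a^sA_1(s,\theta)\mathbf x_D(t,\theta)\,d\theta+\int_s^bA_2(s,\theta)\mathbf x_D(t,\theta)\,d\theta\quad\text{for a.e. }s\in[a,b].$$ **The PIE.** For bounded operators $\mathcal T,\mathcal A$ on $L_2^{n_{\mathbf x}}$ let $\|v\|_{\mathcal T}=\|\mathcal Tv\|_{L_2}$. $\mathbf x_f:[0,\infty)\to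 L_2^{n_{\mathbf x}}$ satisfies the PIE $\mathcal T\dot{\mathbf x}_f=\mathcal A\mathbf x_f$ with initial condition $\mathbf x_f^0$ if, at almost every $t\ge0$, $\mathbf x_f$ is differentiable with respect to $\|\cdot\|_{\mathcal T}$, $\mathbf x_f(0)=\mathbf x_f^0$, and $\mathcal T\dot{\mathbf x}_f(t)=\mathcal A\mathbf x_f(t)$ for almost every $t\ge 0$. Here the derivative $\dot{\mathbf x}_f(t)$ is an element of the completion of $L_2^{n_{\mathbf x}}$ in $\|\cdot\|_{\mathcal T}$, to which $\mathcal T$ is extended by continuity. **The matrices.** Let $$T(s)=\begin{bmatrix}I_{n_1}&0&0\\0&I_{n_2}&sI_{n_2}\\0&0&I_{n_2}\end{bmatrix},\qquad Q(s)=\begin{bmatrix}0&I_{n_1}&0\\0&0&sI_{n_2}\\0&0&I_{n_2}\end{bmatrix},$$ let $T_1(s),Q_1(s)$ consist of their first $n_1+n_2$ rows, and let $U_1\in\mathbb R^{(n_{\mathbf x}+n_S)\times n_{\mathbf x}}$, $U_2\in\mathbb R^{(n_{\mathbf x}+n_S)\times n_S}$ be the matrices with $U_1\mathrm{col}(v_0,v_1,v_2)=\mathrm{col}(v_0,0,0,v_1,0,v_2)$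 and $U_2\mathrm{col}(y_1,y_2,y_3)=\mathrm{col}(0,y_1,y_2,0,y_3,0)$. Let $$B_T=B\begin{bmatrix}T(0)\\T(b-a)\end{bmatrix}-\int_a^bB_I(s)U_2T(s-a)\,ds.$$ The pair $\{n,\mathbf G_{\mathrm b}\}$, with $\mathbf G_{\mathrm b}=\{B,B_I\}$, is *admissible* if $B_T$ is invertible (in particular $n_{BC}=n_S$). In that case put $$B_Q(s)=B_T^{-1}\Big(B_I(s)U_1-B\begin{bmatrix}0\\Q(b-s)\end{bmatrix}+\int_s^bB_I(\theta)U_2Q(\theta-s)\,d\theta\Big),$$ $$G_0=\begin{bmatrix}I_{n_0}&0\\0&0\end{bmatrix},\quad G_2(s,\theta)=\begin{bmatrix}0\\T_1(s-a)B_Q(\theta)\end{bmatrix},\quad G_1(s,\theta)=\begin{bmatrix}0\\Q_1(s-\theta)\end{bmatrix}+G_2(s,\theta),$$ $$R_{D,2}(s,\theta)=U_2T(s-a)B_Q(\theta),\quad R_{D,1}(s,\theta)=R_{D,2}(s,\theta)+U_2Q(s-\theta),\quad \hat A_0(s)=A_0(s)U_1,$$ $$\hat A_1(s,\theta)=A_0(s)R_{D,1}(s,\theta)+A_1(s,\theta)U_1+\int_a^\theta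 A_1(s,\beta)R_{D,2}(\beta,\theta)d\beta+\int_\theta^sA_1(s,\beta)R_{D,1}(\beta,\theta)d\beta+\int_s^bA_2(s,\beta)R_{D,1}(\beta,\theta)d\beta,$$ $$\hat A_2(s,\theta)=A_0(s)R_{D,2}(s,\theta)+A_2(s,\theta)U_1+\int_a^sA_1(s,\beta)R_{D,2}(\beta,\theta)d\beta+\int_s^\theta A_2(s,\beta)R_{D,2}(\beta,\theta)d\beta+\int_\theta^bA_2(s,\beta)R_{D,1}(\beta,\theta)d\beta.$$ **Theorem.** Suppose $\{n,\mathbf G_{\mathrm b}\}$ is admissible. Then the formulas $$(\mathcal Tv)(s)=G_0v(s)+\int_a^sG_1(s,\theta)v(\theta)d\theta+\int_s^bG_2(s,\theta)v(\theta)d\theta,\qquad(\mathcal Av)(s)=\hat A_0(s)v(s)+\int_a^s\hat A_1(s,\theta)v(\theta)d\theta+\int_s^b\hat A_2(s,\theta)v(\theta)d\theta$$ define bounded operators $\mathcal T,\mathcal A$ on $L_2^{n_{\mathbf x}}$. If $B_I$ is essentially bounded, $\mathcal T$ is a 3-PI operator, i.e. it has a representation of this form with an essentially bounded multiplier and separable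 kernels $R(s,\theta)=F(s)^{\top}H(\theta)$ with $F,H$ measurable and essentially bounded; if moreover $A_1,A_2$ are separable in this sense, so is $\mathcal A$. For every $\mathbf x^0\in X$: 1. for every $\mathbf x:[0,\infty)\to X$, $\mathbf x$ satisfies the PDE with initial condition $\mathbf x^0$ if and only if $\mathcal D\mathbf x$ satisfies the PIE defined by $\{\mathcal T,\mathcal A\}$ with initial condition $\mathcal D\mathbf x^0$; 2. every solution $\mathbf x_f$ of the PIE with initial condition $\mathcal D\mathbf x^0$ arises in this way: $\mathbf x=\mathcal T\mathbf x_f$ satisfies the PDE with initial condition $\mathbf x^0$, and $\mathcal D\mathbf x(t)=\mathbf x_f(t)$ for all $t\ge 0$. -/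

import Mathlib

open MeasureTheory Set
open scoped ENNReal Matrix

noncomputable section

namespace PIE

/-! ### Index sets, the space `L₂`, weak derivatives -/

/-- Indices of the state `x = col(x₀, x₁, x₂)`. -/
abbrev IX (n₀ n₁ n₂ : ℕ) : Type := Fin n₀ ⊕ (Fin n₁ ⊕ Fin n₂)

/-- Indices of `x_c = col(x₁, x₂, ∂ₛx₂)`; this set has `n_S = n₁ + 2 n₂` elements. -/
abbrev IC (n₁ n₂ : ℕ) : Type := (Fin n₁ ⊕ Fin n₂) ⊕ Fin n₂

/-- Indices of `x_D = col(x₀, x₁, x₂, ∂ₛx₁, ∂ₛx₂, ∂ₛ²x₂)`; this set has `n_x + n_S` elements. -/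
abbrev ID (n₀ n₁ n₂ : ℕ) : Type := IX n₀ n₁ n₂ ⊕ ((Fin n₁ ⊕ Fin n₂) ⊕ Fin n₂)

/-- Lebesgue measure on `[a,b]`. -/
abbrev mu (a b : ℝ) : Measure ℝ := volume.restrict (Icc a b)

/-- The Hilbert space `L₂[a,b]` of vector-valued square-integrable functions. -/
abbrev L2 (a b : ℝ) (ι : Type) [Fintype ι] : Type :=
  Lp (EuclideanSpace ℝ ι) 2 (mu a b)

/-- `v` is a weak derivative of `u` on the open interval `(a,b)`. -/
def IsWeakDeriv (a b : ℝ) (u v : ℝ → ℝ) : Prop :=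
  ∀ φ : ℝ → ℝ, ContDiff ℝ ((⊤ : ℕ∞) : WithTop ℕ∞) φ → HasCompactSupport φ →
    tsupport φ ⊆ Ioo a b →
      ∫ s, u s * deriv φ s ∂(mu a b) = - ∫ s, v s * φ s ∂(mu a b)

/-- `u` has a weak derivative in `L₂[a,b]`. -/
def HasL2Deriv (a b : ℝ) (u : ℝ → ℝ) : Prop :=
  ∃ v : Lp ℝ 2 (mu a b), IsWeakDeriv a b u v

open Classical in
/-- The weak derivative `∂ₛu ∈ L₂[a,b]` (zero if there is none). -/
def wderiv (a b : ℝ) (u : ℝ → ℝ) : Lp ℝ 2 (mu a b) :=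
  if h : HasL2Deriv a b u then h.choose else 0

section Params

variable {a b : ℝ} {n₀ n₁ n₂ m : ℕ}

/-! ### The state space -/

/-- The entries of `x₁`. -/
def st1 (x : L2 a b (IX n₀ n₁ n₂)) (i : Fin n₁) : ℝ → ℝ := fun s => x s (Sum.inr (Sum.inl i))

/-- The entries of `x₂`. -/
def st2 (x : L2 a b (IX n₀ n₁ n₂)) (j : Fin n₂) : ℝ → ℝ := fun s => x s (Sum.inr (Sum.inr j))

/-- The space `Wⁿ = W₀^{n₀} × W₁^{n₁} × W₂^{n₂}`. -/
def MemW (x : L2 a b (IX n₀ n₁ n₂)) : Prop :=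
  (∀ i, HasL2Deriv a b (st1 x i)) ∧
    ∀ j, HasL2Deriv a b (st2 x j) ∧ HasL2Deriv a b (wderiv a b (st2 x j))

/-- `x_c = col(x₁, x₂, ∂ₛx₂)` (up to null sets). -/
def xC (x : L2 a b (IX n₀ n₁ n₂)) (s : ℝ) : IC n₁ n₂ → ℝ :=
  Sum.elim (Sum.elim (fun i => st1 x i s) (fun j => st2 x j s))
    (fun j => wderiv a b (st2 x j) s)

/-- `x_D = col(x₀, x₁, x₂, ∂ₛx₁, ∂ₛx₂, ∂ₛ²x₂)`. -/
def xD (x : L2 a b (IX n₀ n₁ n₂)) (s : ℝ) : ID n₀ n₁ n₂ → ℝ :=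
  Sum.elim (fun k => x s k)
    (Sum.elim
      (Sum.elim (fun i => wderiv a b (st1 x i) s) (fun j => wderiv a b (st2 x j) s))
      (fun j => wderiv a b (wderiv a b (st2 x j)) s))

/-- The function `col(x₀, ∂ₛx₁, ∂ₛ²x₂)`. -/
def dFun (x : L2 a b (IX n₀ n₁ n₂)) (s : ℝ) : EuclideanSpace ℝ (IX n₀ n₁ n₂) :=
  WithLp.toLp 2 (Sum.elim (fun i => x s (Sum.inl i))
    (Sum.elim (fun i => wderiv a b (st1 x i) s)
      (fun j => wderiv a b (wderiv a b (st2 x j)) s)))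

theorem memLp_dFun (x : L2 a b (IX n₀ n₁ n₂)) : MemLp (dFun x) 2 (mu a b) := by
  refine MemLp.of_eval_piLp ?_
  rintro (i | i | j)
  · exact (Lp.memLp x).eval_piLp (Sum.inl i)
  · exact Lp.memLp (wderiv a b (st1 x i))
  · exact Lp.memLp (wderiv a b (wderiv a b (st2 x j)))

/-- `𝒟x = col(x₀, ∂ₛx₁, ∂ₛ²x₂)` as an element of `L₂`. -/
def D (x : L2 a b (IX n₀ n₁ n₂)) : L2 a b (IX n₀ n₁ n₂) := (memLp_dFun x).toLp (dFun x)

/-! ### Parameters of the PDE -/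

/-- The parameters `G_b = {B, B_I}` of `m = n_BC` boundary conditions. -/
structure BoundaryParams (n₀ n₁ n₂ m : ℕ) where
  B : Matrix (Fin m) (IC n₁ n₂ ⊕ IC n₁ n₂) ℝ
  BI : ℝ → Matrix (Fin m) (ID n₀ n₁ n₂) ℝ

/-- The parameters `G_p = {A₀, A₁, A₂}` of the dynamics. -/
structure DynamicsParams (n₀ n₁ n₂ : ℕ) where
  A0 : ℝ → Matrix (IX n₀ n₁ n₂) (ID n₀ n₁ n₂) ℝ
  A1 : ℝ → ℝ → Matrix (IX n₀ n₁ n₂) (ID n₀ n₁ n₂) ℝ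
  A2 : ℝ → ℝ → Matrix (IX n₀ n₁ n₂) (ID n₀ n₁ n₂) ℝ

/-- Membership in the domain `X`: `x ∈ Wⁿ` and `B col(x_c(a), x_c(b)) = ∫ₐᵇ B_I(s) x_D(s) ds`,
where the boundary values are those of the continuous representative `c` of `x_c`. -/
def MemX (G : BoundaryParams n₀ n₁ n₂ m) (x : L2 a b (IX n₀ n₁ n₂)) : Prop :=
  MemW x ∧ ∃ c : ℝ → IC n₁ n₂ → ℝ, ContinuousOn c (Icc a b) ∧ c =ᵐ[mu a b] xC x ∧
    G.B *ᵥ Sum.elim (c a) (c b) = ∫ s in a..b, G.BI s *ᵥ xD x s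

/-! ### 3-PI operators -/

/-- The function `s ↦ R₀(s)v(s) + ∫ₐˢ R₁(s,θ)v(θ)dθ + ∫ₛᵇ R₂(s,θ)v(θ)dθ`. -/
def piFun {p q : Type} [Fintype q] (a b : ℝ) (R0 : ℝ → Matrix p q ℝ)
    (R1 R2 : ℝ → ℝ → Matrix p q ℝ) [Fintype p] (v : ℝ → q → ℝ) (s : ℝ) :
    EuclideanSpace ℝ p :=
  WithLp.toLp 2
    (R0 s *ᵥ v s + (∫ θ in a..s, R1 s θ *ᵥ v θ) + ∫ θ in s..b, R2 s θ *ᵥ v θ)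

/-- The bounded operator `P` on `L₂` is the operator `𝒫_{R₀,R₁,R₂}`. -/
def IsPI {p q : Type} [Fintype p] [Fintype q] (P : L2 a b q →L[ℝ] L2 a b p)
    (R0 : ℝ → Matrix p q ℝ) (R1 R2 : ℝ → ℝ → Matrix p q ℝ) : Prop :=
  ∀ v : L2 a b q, P v =ᵐ[mu a b] piFun a b R0 R1 R2 (fun s => (v s).ofLp)

/-- Matrix-valued functions with entries in `L_p[a,b]`. -/
def MatMemLp {p q : Type} (a b : ℝ) (r : ℝ≥0∞) (R : ℝ → Matrix p q ℝ) : Prop :=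
  ∀ i j, MemLp (fun s => R s i j) r (mu a b)

/-- Matrix-valued kernels with entries in `L₂([a,b]²)`. -/
def KernelL2 {p q : Type} (a b : ℝ) (R : ℝ → ℝ → Matrix p q ℝ) : Prop :=
  ∀ i j, MemLp (fun z : ℝ × ℝ => R z.1 z.2 i j) 2 ((mu a b).prod (mu a b))

/-- Separable kernels: `R(s,θ) = F(s)ᵀ G(θ)` on `[a,b]²` with essentially bounded `F`, `G`. -/
def Separable {p q : Type} (a b : ℝ) (R : ℝ → ℝ → Matrix p q ℝ) : Prop :=
  ∃ (r : ℕ) (F : ℝ → Matrix (Fin r) p ℝ) (G : ℝ → Matrix (Fin r) q ℝ),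
    MatMemLp a b ⊤ F ∧ MatMemLp a b ⊤ G ∧
      ∀ s ∈ Icc a b, ∀ θ ∈ Icc a b, R s θ = (F s)ᵀ * G θ

/-- The class `Π₃` of 3-PI operators. -/
def Is3PI {p q : Type} [Fintype p] [Fintype q] (P : L2 a b q →L[ℝ] L2 a b p) : Prop :=
  ∃ (R0 : ℝ → Matrix p q ℝ) (R1 R2 : ℝ → ℝ → Matrix p q ℝ),
    MatMemLp a b ⊤ R0 ∧ Separable a b R1 ∧ Separable a b R2 ∧ IsPI P R0 R1 R2

/-! ### Solutions of the PDE -/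

/-- `x` satisfies the PDE
`ẋ(t,s) = A₀(s)x_D(t,s) + ∫ₐˢ A₁(s,θ)x_D(t,θ)dθ + ∫ₛᵇ A₂(s,θ)x_D(t,θ)dθ`, `x(t) ∈ X`,
with initial condition `x0`. Only the values `x t` with `t ≥ 0` matter. -/
structure SatisfiesPDE (G : BoundaryParams n₀ n₁ n₂ m) (P : DynamicsParams n₀ n₁ n₂)
    (x : ℝ → L2 a b (IX n₀ n₁ n₂)) (x0 : L2 a b (IX n₀ n₁ n₂)) : Prop where
  mem : ∀ t, 0 ≤ t → MemX G (x t)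
  diff : ∀ᵐ t ∂(volume.restrict (Ici (0 : ℝ))), DifferentiableAt ℝ x t
  init : x 0 = x0
  eqn : ∀ᵐ t ∂(volume.restrict (Ici (0 : ℝ))),
    (deriv x t : L2 a b (IX n₀ n₁ n₂)) =ᵐ[mu a b] piFun a b P.A0 P.A1 P.A2 (xD (x t))

end Params

/-! ### The `T`-norm and solutions of a PIE -/

section PIESolution

variable {E : Type*} [NormedAddCommGroup E] [NormedSpace ℝ E]

/-- The space `E` with the (semi)norm `‖v‖_T = ‖T v‖`. -/
def TSpace (_T : E →L[ℝ] E) : Type _ := E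

instance (T : E →L[ℝ] E) : AddCommGroup (TSpace T) := inferInstanceAs (AddCommGroup E)

instance (T : E →L[ℝ] E) : Module ℝ (TSpace T) := inferInstanceAs (Module ℝ E)

/-- `T` as a linear map on `TSpace T`. -/
def TSpace.map (T : E →L[ℝ] E) : TSpace T →ₗ[ℝ] E := T.toLinearMap

instance (T : E →L[ℝ] E) : SeminormedAddCommGroup (TSpace T) :=
  SeminormedAddCommGroup.induced (TSpace T) E (TSpace.map T)

instance (T : E →L[ℝ] E) : NormedSpace ℝ (TSpace T) :=
  NormedSpace.induced ℝ (TSpace T) E (TSpace.map T)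

/-- The completion of `E` with respect to the `T`-norm. -/
abbrev TCompletion (T : E →L[ℝ] E) : Type _ := UniformSpace.Completion (TSpace T)

/-- The canonical map from `E` into its completion with respect to the `T`-norm. -/
def TSpace.emb (T : E →L[ℝ] E) (v : E) : TCompletion T :=
  UniformSpace.Completion.coe' (show TSpace T from v)

/-- The continuous extension of `T` to the completion with respect to the `T`-norm. -/
def TSpace.ext (T : E →L[ℝ] E) : TCompletion T → E :=
  UniformSpace.Completion.extension (TSpace.map T)

/-- `xf` satisfies the PIE `T ẋ_f(t) = A x_f(t)` with initial condition `xf0`. The derivative `ẋ_f`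
is the derivative with respect to the `T`-norm; it belongs to the completion of `E` in that norm,
on which `T` acts by continuous extension. Only the values `xf t` with `t ≥ 0` matter. -/
structure SatisfiesPIE (T A : E →L[ℝ] E) (xf : ℝ → E) (xf0 : E) : Prop where
  diff : ∀ᵐ t ∂(volume.restrict (Ici (0 : ℝ))),
    DifferentiableAt ℝ (fun τ => TSpace.emb T (xf τ)) t
  init : xf 0 = xf0
  eqn : ∀ᵐ t ∂(volume.restrict (Ici (0 : ℝ))),
    TSpace.ext T (deriv (fun τ => TSpace.emb T (xf τ)) t) = A (xf t)

end PIESolution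

/-! ### The explicit parameters of the PIE -/

/-- Entrywise integral of a matrix-valued function. -/
def matInt {p q : Type} (c d : ℝ) (F : ℝ → Matrix p q ℝ) : Matrix p q ℝ :=
  Matrix.of fun i j => ∫ s in c..d, F s i j

/-- A matrix with possibly different row and column index sets is invertible. -/
def IsInvertible {p q : Type} [Fintype p] [Fintype q] [DecidableEq p] [DecidableEq q]
    (M : Matrix p q ℝ) : Prop := ∃ N : Matrix q p ℝ, M * N = 1 ∧ N * M = 1

open Classical in
/-- The inverse of an invertible matrix (zero if there is none). -/
def matInv {p q : Type} [Fintype p] [Fintype q] [DecidableEq p] [DecidableEq q]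
    (M : Matrix p q ℝ) : Matrix q p ℝ := if h : IsInvertible M then h.choose else 0

section Kernels

variable {n₀ n₁ n₂ m : ℕ}

/-- The first block row `T₁(s)` of `T(s)`, corresponding to `(x₁, x₂)`. -/
def T1 (n₁ n₂ : ℕ) (s : ℝ) : Matrix (Fin n₁ ⊕ Fin n₂) (IC n₁ n₂) ℝ :=
  Matrix.fromCols 1 (Matrix.fromRows 0 (s • (1 : Matrix (Fin n₂) (Fin n₂) ℝ)))

/-- `T(s) = [I 0 0; 0 I sI; 0 0 I]`. -/
def Tmat (n₁ n₂ : ℕ) (s : ℝ) : Matrix (IC n₁ n₂) (IC n₁ n₂) ℝ :=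
  Matrix.fromRows (T1 n₁ n₂ s) (Matrix.fromCols 0 1)

/-- The first block row `Q₁(s)` of `Q(s)`, corresponding to `(x₁, x₂)`. -/
def Q1 (n₀ n₁ n₂ : ℕ) (s : ℝ) : Matrix (Fin n₁ ⊕ Fin n₂) (IX n₀ n₁ n₂) ℝ :=
  Matrix.fromCols 0 (Matrix.fromBlocks 1 0 0 (s • (1 : Matrix (Fin n₂) (Fin n₂) ℝ)))

/-- `Q(s) = [0 I 0; 0 0 sI; 0 0 I]`. -/
def Qmat (n₀ n₁ n₂ : ℕ) (s : ℝ) : Matrix (IC n₁ n₂) (IX n₀ n₁ n₂) ℝ :=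
  Matrix.fromRows (Q1 n₀ n₁ n₂ s) (Matrix.fromCols 0 (Matrix.fromCols 0 1))

/-- `U₁`, with `U₁ col(x₀, ∂ₛx₁, ∂ₛ²x₂) = col(x₀, 0, 0, ∂ₛx₁, 0, ∂ₛ²x₂)`. -/
def U1 (n₀ n₁ n₂ : ℕ) : Matrix (ID n₀ n₁ n₂) (IX n₀ n₁ n₂) ℝ :=
  Matrix.fromBlocks (Matrix.fromRows 1 0) 0 0
    (Matrix.fromBlocks (Matrix.fromRows 1 0) 0 0 1)

/-- `U₂`, with `U₂ col(x₁, x₂, ∂ₛx₂) = col(0, x₁, x₂, 0, ∂ₛx₂, 0)`. -/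
def U2 (n₀ n₁ n₂ : ℕ) : Matrix (ID n₀ n₁ n₂) (IC n₁ n₂) ℝ :=
  Matrix.fromBlocks (Matrix.fromRows 0 1) 0 0
    (Matrix.fromRows (Matrix.fromRows 0 1) 0)

variable (a b : ℝ) (G : BoundaryParams n₀ n₁ n₂ m) (P : DynamicsParams n₀ n₁ n₂)

/-- `B_T = B [T(0); T(b-a)] - ∫ₐᵇ B_I(s) U₂ T(s-a) ds`. -/
def BT : Matrix (Fin m) (IC n₁ n₂) ℝ :=
  G.B * Matrix.fromRows (Tmat n₁ n₂ 0) (Tmat n₁ n₂ (b - a)) -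
    matInt a b (fun s => G.BI s * U2 n₀ n₁ n₂ * Tmat n₁ n₂ (s - a))

/-- The pair `{n, G_b}` is admissible: `B_T` is invertible. -/
def Admissible : Prop := IsInvertible (BT a b G)

/-- `B_Q(s) = B_T⁻¹ (B_I(s) U₁ - B [0; Q(b-s)] + ∫ₛᵇ B_I(θ) U₂ Q(θ-s) dθ)`. -/
def BQ (s : ℝ) : Matrix (IC n₁ n₂) (IX n₀ n₁ n₂) ℝ :=
  matInv (BT a b G) *
    (G.BI s * U1 n₀ n₁ n₂ - G.B * Matrix.fromRows 0 (Qmat n₀ n₁ n₂ (b - s)) +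
      matInt s b (fun θ => G.BI θ * U2 n₀ n₁ n₂ * Qmat n₀ n₁ n₂ (θ - s)))

/-- `G₀ = diag(I, 0)`. -/
def G0 (n₀ n₁ n₂ : ℕ) (_s : ℝ) : Matrix (IX n₀ n₁ n₂) (IX n₀ n₁ n₂) ℝ :=
  Matrix.fromBlocks 1 0 0 0

/-- `G₂(s,θ) = [0; T₁(s-a) B_Q(θ)]`. -/
def G2 (s θ : ℝ) : Matrix (IX n₀ n₁ n₂) (IX n₀ n₁ n₂) ℝ :=
  Matrix.fromRows 0 (T1 n₁ n₂ (s - a) * BQ a b G θ)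

/-- `G₁(s,θ) = [0; Q₁(s-θ)] + G₂(s,θ)`. -/
def G1 (s θ : ℝ) : Matrix (IX n₀ n₁ n₂) (IX n₀ n₁ n₂) ℝ :=
  Matrix.fromRows 0 (Q1 n₀ n₁ n₂ (s - θ)) + G2 a b G s θ

/-- `R_{D,2}(s,θ) = U₂ T(s-a) B_Q(θ)`. -/
def RD2 (s θ : ℝ) : Matrix (ID n₀ n₁ n₂) (IX n₀ n₁ n₂) ℝ :=
  U2 n₀ n₁ n₂ * Tmat n₁ n₂ (s - a) * BQ a b G θ

/-- `R_{D,1}(s,θ) = R_{D,2}(s,θ) + U₂ Q(s-θ)`. -/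
def RD1 (s θ : ℝ) : Matrix (ID n₀ n₁ n₂) (IX n₀ n₁ n₂) ℝ :=
  RD2 a b G s θ + U2 n₀ n₁ n₂ * Qmat n₀ n₁ n₂ (s - θ)

/-- `Â₀(s) = A₀(s) U₁`. -/
def Ahat0 (s : ℝ) : Matrix (IX n₀ n₁ n₂) (IX n₀ n₁ n₂) ℝ := P.A0 s * U1 n₀ n₁ n₂

/-- The kernel `Â₁(s,θ)`. -/
def Ahat1 (s θ : ℝ) : Matrix (IX n₀ n₁ n₂) (IX n₀ n₁ n₂) ℝ :=
  P.A0 s * RD1 a b G s θ + P.A1 s θ * U1 n₀ n₁ n₂ +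
    matInt a θ (fun β => P.A1 s β * RD2 a b G β θ) +
    matInt θ s (fun β => P.A1 s β * RD1 a b G β θ) +
    matInt s b (fun β => P.A2 s β * RD1 a b G β θ)

/-- The kernel `Â₂(s,θ)`. -/
def Ahat2 (s θ : ℝ) : Matrix (IX n₀ n₁ n₂) (IX n₀ n₁ n₂) ℝ :=
  P.A0 s * RD2 a b G s θ + P.A2 s θ * U1 n₀ n₁ n₂ +
    matInt a s (fun β => P.A1 s β * RD2 a b G β θ) +
    matInt s θ (fun β => P.A2 s β * RD2 a b G β θ) +
    matInt θ b (fun β => P.A2 s β * RD1 a b G β θ)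

end Kernels

end PIE

end

/-!
The boundary conditions make `𝒟 : X → L₂` a bijection with inverse `𝒯`, and everything else is
read off from this.

On an interval, a square-integrable function with a weak derivative in `L₂` is a primitive of that
derivative (lemma of du Bois-Reymond, `ae_eq_const_of_isWeakDeriv_zero`). Hence `x ∈ Wⁿ` if and only
if it satisfies the Taylor formula `x_c(s) = T(s-a) y + ∫ₐˢ Q(s-θ) (𝒟x)(θ) dθ` for some vector `y`,
necessarily `y = x_c(a)` (`MemW.exists_xC_ae_eq_taylor`, `memW_of_ae_eq_taylor`). Inserting this
formula in the boundary conditions and interchanging integrals over a triangle turns them into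
`B_T y = ∫ₐᵇ B_T B_Q(θ) (𝒟x)(θ) dθ`; as `B_T` is invertible, this says `y = ∫ₐᵇ B_Q 𝒟x`
(`boundary_iff`). So `x ∈ X` is determined by `v = 𝒟x`, which is arbitrary in `L₂`, and the Taylor
formula with this `y` is exactly `x = 𝒯v` (`piFun_eq_taylor`, `memX_T`, `T_D`). The same computation
gives `x_D = ℛ v` for the operator `ℛ` with parameters `U₁, R_{D,1}, R_{D,2}` (`RD_D_ae_eq`).

All kernels are in `L₂([a,b]²)`, so the operators are bounded of Hilbert–Schmidt type, up to a
bounded multiplier (`exists_isPI`). The operator `𝒜` is the composition of `ℛ` with the operator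
given by `A₀, A₁, A₂`; its kernels are found by Fubini's theorem (`IsPI.comp`), for which it matters
that the kernels `R_{D,i}` are separable with square-integrable factors. Separability of the kernels
in the bounded case is preserved by the integrals in `Â₁` and `Â₂`: between the factors depending on
`s` and on `θ` they leave the increment of a primitive between two of the points `a, b, s, θ`
(`IsSepKernel.matInt`).

Finally, the extension of `𝒯` to the completion in the `𝒯`-norm is a linear isometry, with closed
range, so differentiability of `𝒟x` in the `𝒯`-norm is differentiability of `𝒯𝒟x = x` in `L₂`, and
the extension of `𝒯` maps one derivative to the other (`TSpace.differentiableAt_emb_iff`). The PIE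
for `𝒟x` is therefore the PDE for `x`.
-/

namespace PIE

/-! ### Integrals over subintervals -/

section Interval

variable {E : Type*} [NormedAddCommGroup E] [NormedSpace ℝ E] {a b : ℝ}

theorem intervalIntegral_eq_integral_mu (hab : a ≤ b) (f : ℝ → E) :
    ∫ s in a..b, f s = ∫ s, f s ∂(mu a b) := by
  rw [intervalIntegral.integral_of_le hab, integral_Icc_eq_integral_Ioc]

theorem intervalIntegral_left_eq {s : ℝ} (hs : s ∈ Icc a b) (f : ℝ → E) :
    ∫ θ in a..s, f θ = ∫ θ, (Iic s).indicator f θ ∂(mu a b) := by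
  rw [intervalIntegral.integral_of_le hs.1, integral_indicator measurableSet_Iic,
    Measure.restrict_restrict measurableSet_Iic, ← integral_Icc_eq_integral_Ioc]
  congr 2
  ext x
  simp only [mem_Icc, mem_inter_iff, mem_Iic]
  have := hs.2
  grind

theorem intervalIntegral_right_eq {s : ℝ} (hs : s ∈ Icc a b) (f : ℝ → E) :
    ∫ θ in s..b, f θ = ∫ θ, (Ioi s).indicator f θ ∂(mu a b) := by
  rw [intervalIntegral.integral_of_le hs.2, integral_indicator measurableSet_Ioi,
    Measure.restrict_restrict measurableSet_Ioi]
  congr 2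
  ext x
  simp only [mem_Icc, mem_inter_iff, mem_Ioi, mem_Ioc]
  have := hs.1
  grind

theorem ae_mem_Icc : ∀ᵐ s ∂(mu a b), s ∈ Icc a b := ae_restrict_mem measurableSet_Icc

theorem ae_mu_ne (s : ℝ) : ∀ᵐ θ ∂(mu a b), θ ≠ s := by
  have h : mu a b {s} = 0 := measure_singleton s
  exact measure_eq_zero_iff_ae_notMem.1 h

theorem intervalIntegrable_of_integrable {F : Type*} [NormedAddCommGroup F] {f : ℝ → F}
    (hf : Integrable f (mu a b)) {c d : ℝ}
    (hc : c ∈ Icc a b) (hd : d ∈ Icc a b) : IntervalIntegrable f volume c d :=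
  IntegrableOn.intervalIntegrable
    (IntegrableOn.mono_set hf (uIcc_subset_Icc hc hd))

theorem continuousOn_primitive (hab : a ≤ b) {g : ℝ → ℝ} (hg : Integrable g (mu a b)) :
    ContinuousOn (fun s => ∫ θ in a..s, g θ) (Icc a b) := by
  have := intervalIntegral.continuousOn_primitive_interval (μ := volume) (f := g)
    (a := a) (b := b) (by rwa [uIcc_of_le hab])
  rwa [uIcc_of_le hab] at this

theorem intervalIntegrable_finsetSum {ι : Type*} (t : Finset ι) {f : ι → ℝ → ℝ} {c d : ℝ}
    (hf : ∀ j ∈ t, IntervalIntegrable (f j) volume c d) :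
    IntervalIntegrable (fun θ => ∑ j ∈ t, f j θ) volume c d := by
  have := IntervalIntegrable.sum t hf
  rwa [show (∑ j ∈ t, f j) = fun θ => ∑ j ∈ t, f j θ by ext θ; simp] at this

/-- Interchange of the order of integration over the triangle `a ≤ θ ≤ s ≤ b`. -/
theorem integral_triangle_swap (hab : a ≤ b) {H : ℝ → ℝ → E}
    (hH : Integrable (Function.uncurry H) ((mu a b).prod (mu a b))) :
    ∫ s in a..b, ∫ θ in a..s, H s θ = ∫ θ in a..b, ∫ s in θ..b, H s θ := by
  rw [intervalIntegral_eq_integral_mu hab, intervalIntegral_eq_integral_mu hab]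
  have h1 : ∫ s, (∫ θ in a..s, H s θ) ∂(mu a b) =
      ∫ s, ∫ θ, (Iic s).indicator (H s) θ ∂(mu a b) ∂(mu a b) := by
    refine integral_congr_ae ?_
    filter_upwards [ae_mem_Icc] with s hs using intervalIntegral_left_eq hs _
  have h2 : ∫ θ, (∫ s in θ..b, H s θ) ∂(mu a b) =
      ∫ θ, ∫ s, (Iic s).indicator (H s) θ ∂(mu a b) ∂(mu a b) := by
    refine integral_congr_ae ?_
    filter_upwards [ae_mem_Icc] with θ hθ
    rw [intervalIntegral_right_eq hθ]
    refine integral_congr_ae ?_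
    filter_upwards [ae_mu_ne θ] with s hs
    simp only [indicator, mem_Ioi, mem_Iic]
    grind
  rw [h1, h2]
  refine integral_integral_swap ?_
  have : (Function.uncurry fun s θ => (Iic s).indicator (H s) θ) =
      {z : ℝ × ℝ | z.2 ≤ z.1}.indicator (Function.uncurry H) := by
    ext ⟨s, θ⟩
    simp [indicator, Function.uncurry]
  rw [this]
  exact hH.indicator (measurableSet_le measurable_snd measurable_fst)

end Interval

/-! ### Weak derivatives on an interval -/

section WeakDeriv

variable {a b : ℝ}

theorem IsWeakDeriv.congr {u u' v v' : ℝ → ℝ} (h : IsWeakDeriv a b u v)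
    (hu : u =ᵐ[mu a b] u') (hv : v =ᵐ[mu a b] v') : IsWeakDeriv a b u' v' := by
  intro φ h1 h2 h3
  have e1 : ∫ s, u' s * deriv φ s ∂(mu a b) = ∫ s, u s * deriv φ s ∂(mu a b) :=
    integral_congr_ae (by filter_upwards [hu] with s hs; rw [hs])
  have e2 : ∫ s, v' s * φ s ∂(mu a b) = ∫ s, v s * φ s ∂(mu a b) :=
    integral_congr_ae (by filter_upwards [hv] with s hs; rw [hs])
  rw [e1, e2, h φ h1 h2 h3]

theorem isWeakDeriv_wderiv {u : ℝ → ℝ} (h : HasL2Deriv a b u) :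
    IsWeakDeriv a b u (wderiv a b u) := by
  rw [wderiv, dif_pos h]
  exact h.choose_spec

theorem integrable_mul_of_continuous {f g : ℝ → ℝ} (hf : Integrable f (mu a b))
    (hg : Continuous g) : Integrable (fun s => f s * g s) (mu a b) :=
  IntegrableOn.mul_continuousOn (K := Icc a b) hf hg.continuousOn isCompact_Icc

theorem integrable_of_continuous {g : ℝ → ℝ} (hg : Continuous g) : Integrable g (mu a b) :=
  hg.continuousOn.integrableOn_Icc

theorem ae_eq_zero_of_forall_test {w : ℝ → ℝ} (hw : Integrable w (mu a b))
    (h : ∀ φ : ℝ → ℝ, ContDiff ℝ ((⊤ : ℕ∞) : WithTop ℕ∞) φ → HasCompactSupport φ →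
      tsupport φ ⊆ Ioo a b → ∫ s, w s * φ s ∂(mu a b) = 0) : w =ᵐ[mu a b] 0 := by
  have h1 := isOpen_Ioo.ae_eq_zero_of_integral_contDiff_smul_eq_zero (U := Ioo a b) (μ := mu a b)
    (hw.locallyIntegrable.locallyIntegrableOn _) (fun g h1 h2 h3 => by
      simpa [mul_comm] using h g h1 h2 h3)
  filter_upwards [h1, ae_mem_Icc, ae_mu_ne a, ae_mu_ne b] with s hs hs1 hs2 hs3
  exact hs ⟨lt_of_le_of_ne hs1.1 (Ne.symm hs2), lt_of_le_of_ne hs1.2 hs3⟩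

theorem IsWeakDeriv.unique {u v v' : ℝ → ℝ} (hv : Integrable v (mu a b))
    (hv' : Integrable v' (mu a b)) (h : IsWeakDeriv a b u v) (h' : IsWeakDeriv a b u v') :
    v =ᵐ[mu a b] v' := by
  have := ae_eq_zero_of_forall_test (hv.sub hv') (fun φ h1 h2 h3 => by
    have e := h φ h1 h2 h3
    rw [h' φ h1 h2 h3] at e
    simp only [Pi.sub_apply, sub_mul]
    rw [integral_sub (integrable_mul_of_continuous hv h1.continuous)
      (integrable_mul_of_continuous hv' h1.continuous)]
    linarith)
  filter_upwards [this] with s hs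
  simpa [sub_eq_zero] using hs

/-- A primitive of an integrable function is weakly differentiable, by Fubini on a triangle. -/
theorem isWeakDeriv_primitive (hab : a < b) {g : ℝ → ℝ} (hg : Integrable g (mu a b)) (y : ℝ) :
    IsWeakDeriv a b (fun s => y + ∫ θ in a..s, g θ) g := by
  intro φ h1 h2 h3
  have hφa : φ a = 0 := image_eq_zero_of_notMem_tsupport (fun h => lt_irrefl _ (h3 h).1)
  have hφb : φ b = 0 := image_eq_zero_of_notMem_tsupport (fun h => lt_irrefl _ (h3 h).2)
  have hd : Continuous (deriv φ) := h1.continuous_deriv (by simp)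
  have hdi : Integrable (deriv φ) (mu a b) := integrable_of_continuous hd
  have ftc (c : ℝ) : ∫ s in c..b, deriv φ s = -φ c := by
    rw [intervalIntegral.integral_deriv_eq_sub (fun x _ => (h1.differentiable (by simp)) x)
      (hd.intervalIntegrable _ _), hφb, zero_sub]
  have hI : Integrable (fun s => (∫ θ in a..s, g θ) * deriv φ s) (mu a b) := by
    have hc := (continuousOn_primitive hab.le hg).mul hd.continuousOn
    exact hc.integrableOn_Icc
  have hswap : ∫ s in a..b, ∫ θ in a..s, deriv φ s * g θ = ∫ θ in a..b, ∫ s in θ..b,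
      deriv φ s * g θ := integral_triangle_swap hab.le (hdi.mul_prod hg)
  simp only [add_mul]
  rw [integral_add (hdi.const_mul y) hI, integral_const_mul,
    ← intervalIntegral_eq_integral_mu hab.le (deriv φ), ftc a, hφa,
    ← intervalIntegral_eq_integral_mu hab.le, ← intervalIntegral_eq_integral_mu hab.le,
    ← intervalIntegral.integral_neg]
  simp only [neg_zero, mul_zero, zero_add]
  simp only [intervalIntegral.integral_const_mul, intervalIntegral.integral_mul_const, ftc] at hswap
  simp only [mul_comm _ (deriv φ _), hswap]
  exact intervalIntegral.integral_congr fun s _ => by ring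

/-- A compact subset of `(a,b)` keeps a distance from the end points. -/
theorem exists_subset_Icc_of_isCompact (hab : a < b) {K : Set ℝ} (hK : IsCompact K)
    (hKs : K ⊆ Ioo a b) : ∃ c d, a < c ∧ c ≤ d ∧ d < b ∧ K ⊆ Icc c d := by
  rcases K.eq_empty_or_nonempty with rfl | hne
  · exact ⟨(a + b) / 2, (a + b) / 2, by linarith, le_rfl, by linarith, empty_subset _⟩
  · obtain ⟨c, hc⟩ := hK.exists_isLeast hne
    obtain ⟨d, hd⟩ := hK.exists_isGreatest hne
    exact ⟨c, d, (hKs hc.1).1, hc.2 hd.1, (hKs hd.1).2, fun x hx => ⟨hc.2 hx, hd.2 hx⟩⟩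

/-- A test function on `(a,b)` of mean zero is the derivative of a test function on `(a,b)`. -/
theorem exists_test_primitive (hab : a < b) {h : ℝ → ℝ}
    (h1 : ContDiff ℝ ((⊤ : ℕ∞) : WithTop ℕ∞) h) (h2 : HasCompactSupport h)
    (h3 : tsupport h ⊆ Ioo a b) (h0 : ∫ s in a..b, h s = 0) :
    ∃ φ : ℝ → ℝ, ContDiff ℝ ((⊤ : ℕ∞) : WithTop ℕ∞) φ ∧ HasCompactSupport φ ∧
      tsupport φ ⊆ Ioo a b ∧ deriv φ = h := by
  obtain ⟨c, d, hac, hcd, hdb, hK⟩ := exists_subset_Icc_of_isCompact hab h2 h3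
  have hz (x : ℝ) (hx : x ∉ Icc c d) : h x = 0 :=
    image_eq_zero_of_notMem_tsupport (fun h => hx (hK h))
  have hderiv (x : ℝ) : HasDerivAt (fun s => ∫ θ in a..s, h θ) (h x) x :=
    h1.continuous.integral_hasStrictDerivAt a x |>.hasDerivAt
  have hd : deriv (fun s => ∫ θ in a..s, h θ) = h := funext fun x => (hderiv x).deriv
  have hzero (s : ℝ) (hs : s ∉ Icc c d) : ∫ θ in a..s, h θ = 0 := by
    rcases lt_or_ge s c with hsc | hsc
    · refine intervalIntegral.integral_zero_ae (Filter.Eventually.of_forall fun x hx => hz x ?_)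
      rw [uIoc, mem_Ioc] at hx
      have : x < c := lt_of_le_of_lt hx.2 (max_lt hac hsc)
      exact fun hx' => absurd hx'.1 (not_le.2 this)
    · have hsd : d < s := not_le.1 fun h => hs ⟨hsc, h⟩
      have hi := fun x y => h1.continuous.intervalIntegrable (μ := volume) x y
      rw [← intervalIntegral.integral_add_adjacent_intervals (hi a b) (hi b s), h0, zero_add]
      refine intervalIntegral.integral_zero_ae (Filter.Eventually.of_forall fun x hx => hz x ?_)
      rw [uIoc, mem_Ioc] at hx
      have : d < x := lt_of_le_of_lt (le_min hdb.le hsd.le) hx.1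
      exact fun hx' => absurd hx'.2 (not_le.2 this)
  have hsupp : tsupport (fun s => ∫ θ in a..s, h θ) ⊆ Icc c d := by
    refine closure_minimal (fun s hs => ?_) isClosed_Icc
    by_contra hn
    exact hs (hzero s hn)
  refine ⟨fun s => ∫ θ in a..s, h θ, ?_, ?_, hsupp.trans ?_, hd⟩
  · rw [contDiff_infty_iff_deriv, hd]
    exact ⟨fun x => (hderiv x).differentiableAt, h1⟩
  · exact isCompact_Icc.of_isClosed_subset (isClosed_tsupport _) hsupp
  · exact fun x hx => ⟨hac.trans_le hx.1, hx.2.trans_lt hdb⟩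

theorem exists_test_integral_one (hab : a < b) : ∃ ψ : ℝ → ℝ,
    ContDiff ℝ ((⊤ : ℕ∞) : WithTop ℕ∞) ψ ∧ HasCompactSupport ψ ∧
      tsupport ψ ⊆ Ioo a b ∧ ∫ s in a..b, ψ s = 1 := by
  let f : ContDiffBump ((a + b) / 2) := ⟨(b - a) / 8, (b - a) / 4, by linarith, by linarith⟩
  have hts : tsupport (f.normed volume) ⊆ Ioo a b := by
    rw [f.tsupport_normed_eq, Real.closedBall_eq_Icc]
    intro x hx
    have h4 : f.rOut = (b - a) / 4 := rfl
    rw [h4] at hx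
    exact ⟨by linarith [hx.1], by linarith [hx.2]⟩
  refine ⟨f.normed volume, f.contDiff_normed, f.hasCompactSupport_normed, hts, ?_⟩
  rw [← f.integral_normed (μ := volume), intervalIntegral.integral_of_le hab.le,
    setIntegral_eq_integral_of_forall_compl_eq_zero]
  intro x hx
  exact image_eq_zero_of_notMem_tsupport fun h => hx ⟨(hts h).1, (hts h).2.le⟩

/-- The lemma of du Bois-Reymond: an integrable function with weak derivative zero is constant. -/
theorem ae_eq_const_of_isWeakDeriv_zero (hab : a < b) {w : ℝ → ℝ} (hw : Integrable w (mu a b))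
    (h : IsWeakDeriv a b w 0) : ∃ y : ℝ, w =ᵐ[mu a b] fun _ => y := by
  obtain ⟨ψ, p1, p2, p3, p4⟩ := exists_test_integral_one hab
  refine ⟨∫ s, w s * ψ s ∂(mu a b), ?_⟩
  set y := ∫ s, w s * ψ s ∂(mu a b) with hy
  have := ae_eq_zero_of_forall_test (hw.sub (integrable_of_continuous (continuous_const (y := y))))
    (fun φ h1 h2 h3 => ?_)
  · filter_upwards [this] with s hs
    simpa [sub_eq_zero] using hs
  -- Subtracting its mean times `ψ` turns a test function into the derivative of a test function.
  set q := ∫ s in a..b, φ s with hq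
  have hφi := h1.continuous
  have hψi := p1.continuous
  have hsub : tsupport (fun s => φ s - q * ψ s) ⊆ tsupport φ ∪ tsupport ψ :=
    closure_minimal (fun s hs => by
      by_contra hn
      rw [mem_union, not_or] at hn
      exact hs (by simp [image_eq_zero_of_notMem_tsupport hn.1,
        image_eq_zero_of_notMem_tsupport hn.2]))
      ((isClosed_tsupport _).union (isClosed_tsupport _))
  obtain ⟨Φ, f1, f2, f3, f4⟩ := exists_test_primitive hab (h := fun s => φ s - q * ψ s)
    (h1.sub (contDiff_const.mul p1))
    (IsCompact.of_isClosed_subset (IsCompact.union h2 p2) (isClosed_tsupport _) hsub)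
    (hsub.trans (union_subset h3 p3)) (by
      rw [intervalIntegral.integral_sub (hφi.intervalIntegrable _ _)
        ((hψi.intervalIntegrable _ _).const_mul q), intervalIntegral.integral_const_mul, p4, ← hq]
      ring)
  have e := h Φ f1 f2 f3
  rw [f4] at e
  have e2 : (∫ s, w s * φ s ∂(mu a b)) - q * y = 0 := by
    rw [hy, ← integral_const_mul, ← integral_sub (integrable_mul_of_continuous hw hφi)
      ((integrable_mul_of_continuous hw hψi).const_mul q)]
    simp only [Pi.zero_apply, zero_mul, integral_zero, neg_zero] at e
    rw [← e]
    exact integral_congr_ae (.of_forall fun s => by ring)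
  simp only [Pi.sub_apply, sub_mul]
  rw [integral_sub (integrable_mul_of_continuous hw hφi)
    ((integrable_of_continuous hφi).const_mul y), integral_const_mul,
    ← intervalIntegral_eq_integral_mu hab.le φ, ← hq]
  linarith

theorem integrable_of_memLp_two {f : ℝ → ℝ} (hf : MemLp f 2 (mu a b)) : Integrable f (mu a b) :=
  hf.integrable (by norm_num)

/-- A function with a weak derivative in `L₂` is a primitive of it. -/
theorem exists_ae_eq_primitive (hab : a < b) {u : ℝ → ℝ} (hu : Integrable u (mu a b))
    (h : HasL2Deriv a b u) :
    ∃ y : ℝ, u =ᵐ[mu a b] fun s => y + ∫ θ in a..s, wderiv a b u θ := by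
  have hv : Integrable (wderiv a b u) (mu a b) := integrable_of_memLp_two (Lp.memLp _)
  have hp : Integrable (fun s => ∫ θ in a..s, wderiv a b u θ) (mu a b) :=
    (continuousOn_primitive hab.le hv).integrableOn_Icc
  obtain ⟨y, hy⟩ := ae_eq_const_of_isWeakDeriv_zero hab (hu.sub hp) (by
    intro φ h1 h2 h3
    have hd : Continuous (deriv φ) := h1.continuous_deriv (by simp)
    have e1 := isWeakDeriv_wderiv h φ h1 h2 h3
    have e2 := isWeakDeriv_primitive hab hv 0 φ h1 h2 h3
    simp only [zero_add] at e2
    simp only [Pi.sub_apply, sub_mul, Pi.zero_apply, zero_mul, integral_zero, neg_zero]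
    rw [integral_sub (integrable_mul_of_continuous hu hd) (integrable_mul_of_continuous hp hd),
      e1, e2, sub_self])
  refine ⟨y, ?_⟩
  filter_upwards [hy] with s hs
  simp only [Pi.sub_apply] at hs
  linarith

theorem hasL2Deriv_of_ae_eq_primitive (hab : a < b) {u g : ℝ → ℝ} (hg : MemLp g 2 (mu a b)) {y : ℝ}
    (hu : u =ᵐ[mu a b] fun s => y + ∫ θ in a..s, g θ) :
    HasL2Deriv a b u ∧ wderiv a b u =ᵐ[mu a b] g := by
  have hgi := integrable_of_memLp_two hg
  have hw : IsWeakDeriv a b u g := (isWeakDeriv_primitive hab hgi y).congr hu.symm .rfl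
  have hd : HasL2Deriv a b u := ⟨hg.toLp g, hw.congr .rfl hg.coeFn_toLp.symm⟩
  exact ⟨hd, (isWeakDeriv_wderiv hd).unique (integrable_of_memLp_two (Lp.memLp _)) hgi hw⟩

end WeakDeriv

/-! ### Bounded integral operators on `L₂` -/

section HilbertSchmidt

variable {α : Type*} [MeasurableSpace α] {μ : Measure α}

theorem memLp_two_slice_ae [SFinite μ] {K : α × α → ℝ} (hK : MemLp K 2 (μ.prod μ)) :
    ∀ᵐ s ∂μ, MemLp (fun θ => K (s, θ)) 2 μ := by
  have h1 := (memLp_two_iff_integrable_sq hK.1).1 hK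
  filter_upwards [h1.prod_right_ae, hK.1.prodMk_left] with s hs hs'
  exact (memLp_two_iff_integrable_sq hs').2 hs

/-- The Cauchy–Schwarz inequality. -/
theorem sq_integral_mul_le {k v : α → ℝ} (hk : MemLp k 2 μ) (hv : MemLp v 2 μ) :
    (∫ θ, k θ * v θ ∂μ) ^ 2 ≤ (∫ θ, k θ ^ 2 ∂μ) * ∫ θ, v θ ^ 2 ∂μ := by
  have hin (f g : α → ℝ) (hf : MemLp f 2 μ) (hg : MemLp g 2 μ) :
      inner ℝ (hf.toLp f) (hg.toLp g) = ∫ θ, f θ * g θ ∂μ := by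
    rw [L2.inner_def]
    refine integral_congr_ae ?_
    filter_upwards [hf.coeFn_toLp, hg.coeFn_toLp] with θ h1 h2
    simp [h1, h2, mul_comm]
  have h := real_inner_mul_inner_self_le (hk.toLp k) (hv.toLp v)
  simp only [hin] at h
  simpa only [sq] using h

theorem norm_sq_eq_integral_sq (v : Lp ℝ 2 μ) : ‖v‖ ^ 2 = ∫ θ, v θ ^ 2 ∂μ := by
  rw [← real_inner_self_eq_norm_sq, L2.inner_def]
  simp [sq]

/-- A square-integrable kernel defines a bounded (Hilbert–Schmidt) operator on `L₂`. -/
theorem exists_clm_integral_kernel [SFinite μ] {K : α × α → ℝ} (hK : MemLp K 2 (μ.prod μ)) :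
    ∃ P : Lp ℝ 2 μ →L[ℝ] Lp ℝ 2 μ, ∀ v, P v =ᵐ[μ] fun s => ∫ θ, K (s, θ) * v θ ∂μ := by
  have hsl := memLp_two_slice_ae hK
  have hksq := (memLp_two_iff_integrable_sq hK.1).1 hK
  have hk : Integrable (fun s => ∫ θ, K (s, θ) ^ 2 ∂μ) μ := hksq.integral_prod_left
  have hbound (v : Lp ℝ 2 μ) : ∀ᵐ s ∂μ,
      (∫ θ, K (s, θ) * v θ ∂μ) ^ 2 ≤ (∫ θ, K (s, θ) ^ 2 ∂μ) * ‖v‖ ^ 2 := by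
    filter_upwards [hsl] with s hs
    rw [norm_sq_eq_integral_sq]
    exact sq_integral_mul_le hs (Lp.memLp v)
  have hmeas (v : Lp ℝ 2 μ) : AEStronglyMeasurable (fun s => ∫ θ, K (s, θ) * v θ ∂μ) μ :=
    (hK.1.mul (Lp.aestronglyMeasurable v).comp_snd).integral_prod_right'
  have hint (v : Lp ℝ 2 μ) : Integrable (fun s => (∫ θ, K (s, θ) * v θ ∂μ) ^ 2) μ := by
    refine (hk.mul_const (‖v‖ ^ 2)).mono ((hmeas v).pow 2) ?_
    filter_upwards [hbound v] with s hs
    rw [Real.norm_eq_abs, abs_of_nonneg (sq_nonneg _)]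
    exact hs.trans (le_abs_self _)
  have hmem (v : Lp ℝ 2 μ) : MemLp (fun s => ∫ θ, K (s, θ) * v θ ∂μ) 2 μ :=
    (memLp_two_iff_integrable_sq (hmeas v)).2 (hint v)
  let P : Lp ℝ 2 μ →ₗ[ℝ] Lp ℝ 2 μ :=
    { toFun := fun v => (hmem v).toLp _
      map_add' := fun v w => by
        rw [← MemLp.toLp_add]
        refine (MemLp.toLp_eq_toLp_iff _ _).2 ?_
        filter_upwards [hsl] with s hs
        have e : ∫ θ, K (s, θ) * (v + w : Lp ℝ 2 μ) θ ∂μ =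
            ∫ θ, K (s, θ) * v θ + K (s, θ) * w θ ∂μ := by
          refine integral_congr_ae ?_
          filter_upwards [Lp.coeFn_add v w] with θ hθ
          rw [hθ, Pi.add_apply, mul_add]
        rw [Pi.add_apply, e]
        exact integral_add (hs.integrable_mul (Lp.memLp v)) (hs.integrable_mul (Lp.memLp w))
      map_smul' := fun c v => by
        rw [RingHom.id_apply, ← MemLp.toLp_const_smul]
        refine (MemLp.toLp_eq_toLp_iff _ _).2 (.of_forall fun s => ?_)
        rw [Pi.smul_apply, smul_eq_mul, ← integral_const_mul]
        refine integral_congr_ae ?_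
        filter_upwards [Lp.coeFn_smul c v] with θ hθ
        rw [hθ, Pi.smul_apply, smul_eq_mul]
        ring }
  refine ⟨P.mkContinuous (√(∫ s, ∫ θ, K (s, θ) ^ 2 ∂μ ∂μ)) fun v => ?_,
    fun v => (hmem v).coeFn_toLp⟩
  have h0 : 0 ≤ ∫ s, ∫ θ, K (s, θ) ^ 2 ∂μ ∂μ :=
    integral_nonneg fun s => integral_nonneg fun θ => sq_nonneg _
  refine (sq_le_sq₀ (norm_nonneg _) (by positivity)).1 ?_
  rw [mul_pow, Real.sq_sqrt h0, norm_sq_eq_integral_sq, ← integral_mul_const]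
  refine integral_mono_ae ?_ (hk.mul_const _) ?_
  · exact (hint v).congr (by filter_upwards [(hmem v).coeFn_toLp] with s hs; simp [P, hs])
  · filter_upwards [(hmem v).coeFn_toLp, hbound v] with s hs h2
    simpa [P, hs] using h2

theorem exists_clm_mul {r : α → ℝ} (hr : MemLp r ⊤ μ) :
    ∃ P : Lp ℝ 2 μ →L[ℝ] Lp ℝ 2 μ, ∀ v, P v =ᵐ[μ] fun s => r s * v s := by
  refine ⟨(ContinuousLinearMap.mul ℝ ℝ).holderL μ ⊤ 2 2 (hr.toLp r), fun v => ?_⟩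
  have h := ContinuousLinearMap.coeFn_holder (r := 2) (ContinuousLinearMap.mul ℝ ℝ) (hr.toLp r) v
  filter_upwards [h, hr.coeFn_toLp] with s h1 h2
  have : ((ContinuousLinearMap.mul ℝ ℝ).holderL μ ⊤ 2 2 (hr.toLp r)) v =
    (ContinuousLinearMap.mul ℝ ℝ).holder 2 (hr.toLp r) v := rfl
  rw [this, h1, h2]
  rfl

theorem coeFn_finset_sum {ι E : Type*} [NormedAddCommGroup E] (t : Finset ι) (f : ι → Lp E 2 μ) :
    (∑ i ∈ t, f i : Lp E 2 μ) =ᵐ[μ] fun s => ∑ i ∈ t, f i s := by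
  classical
  induction t using Finset.induction_on with
  | empty => exact Lp.coeFn_zero E 2 μ
  | insert i t hi ih =>
    simp only [Finset.sum_insert hi]
    filter_upwards [Lp.coeFn_add (f i) (∑ j ∈ t, f j), ih] with s h1 h2
    rw [h1, Pi.add_apply, h2]

/-- The `j`-th coordinate of a vector-valued square-integrable function. -/
noncomputable def coordL2 {q : Type} [Fintype q] (μ : Measure α) (j : q) :
    Lp (EuclideanSpace ℝ q) 2 μ →L[ℝ] Lp ℝ 2 μ :=
  (EuclideanSpace.proj j : EuclideanSpace ℝ q →L[ℝ] ℝ).compLpL 2 μ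

/-- Matrices of bounded operators on the scalar space `L₂` are bounded operators on the
vector-valued spaces. -/
theorem exists_clm_of_entries {p q : Type} [Fintype p] [Fintype q]
    (A : p → q → Lp ℝ 2 μ →L[ℝ] Lp ℝ 2 μ) :
    ∃ P : Lp (EuclideanSpace ℝ q) 2 μ →L[ℝ] Lp (EuclideanSpace ℝ p) 2 μ,
      ∀ v, ∀ᵐ s ∂μ, ∀ i, P v s i =
        ∑ j, A i j (coordL2 μ j v) s := by
  classical
  let ins (i : p) : ℝ →L[ℝ] EuclideanSpace ℝ p :=
    (ContinuousLinearMap.id ℝ ℝ).smulRight (EuclideanSpace.single i (1 : ℝ))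
  refine ⟨∑ i, (ins i).compLpL 2 μ ∘L ∑ j, A i j ∘L
    coordL2 μ j, fun v => ?_⟩
  set w : p → Lp ℝ 2 μ := fun i =>
    ∑ j, A i j (coordL2 μ j v) with hw
  have e : (∑ i, (ins i).compLpL 2 μ ∘L ∑ j, A i j ∘L
      coordL2 μ j) v =
      ∑ i, (ins i).compLpL 2 μ (w i) := by
    simp [hw]
  rw [e]
  have h1 := coeFn_finset_sum Finset.univ fun i => (ins i).compLpL 2 μ (w i)
  have h2 : ∀ᵐ s ∂μ, ∀ i, (ins i).compLpL 2 μ (w i) s = ins i (w i s) :=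
    ae_all_iff.2 fun i => ContinuousLinearMap.coeFn_compLpL _ _
  have h3 : ∀ᵐ s ∂μ, ∀ i, w i s = ∑ j, A i j
      (coordL2 μ j v) s :=
    ae_all_iff.2 fun i => coeFn_finset_sum _ _
  filter_upwards [h1, h2, h3] with s e1 e2 e3 i
  rw [e1, ← e3]
  simp [e2, ins, Finset.sum_apply, Pi.single_apply]

end HilbertSchmidt

/-! ### 3-PI operators with square-integrable kernels -/

section Triangular

variable {p q : Type} {a b : ℝ}

/-- The kernel on the square that is `R1` on the triangle `θ ≤ s` and `R2` on the triangle
`s < θ`. -/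
noncomputable def triKernel (R1 R2 : ℝ → ℝ → Matrix p q ℝ) (s θ : ℝ) : Matrix p q ℝ :=
  if θ ≤ s then R1 s θ else R2 s θ

theorem KernelL2.triKernel {R1 R2 : ℝ → ℝ → Matrix p q ℝ} (h1 : KernelL2 a b R1)
    (h2 : KernelL2 a b R2) : KernelL2 a b (triKernel R1 R2) := by
  intro i j
  have hS : MeasurableSet {z : ℝ × ℝ | z.2 ≤ z.1} := measurableSet_le measurable_snd measurable_fst
  refine (((h1 i j).indicator hS).add ((h2 i j).indicator hS.compl)).ae_eq (.of_forall ?_)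
  rintro ⟨s, θ⟩
  by_cases h : θ ≤ s <;> simp [PIE.triKernel, h, indicator]

theorem KernelL2.slice_ae [Fintype p] [Fintype q] {R : ℝ → ℝ → Matrix p q ℝ}
    (h : KernelL2 a b R) : ∀ᵐ s ∂(mu a b), ∀ i j, MemLp (fun θ => R s θ i j) 2 (mu a b) :=
  ae_all_iff.2 fun i => ae_all_iff.2 fun j => memLp_two_slice_ae (h i j)

variable [Fintype p] [Fintype q]

theorem intervalIntegral_pi_apply {F : ℝ → p → ℝ} {c d : ℝ}
    (h : ∀ i, IntervalIntegrable (fun θ => F θ i) volume c d) (i : p) :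
    (∫ θ in c..d, F θ) i = ∫ θ in c..d, F θ i := by
  have h' : IntervalIntegrable F volume c d :=
    ⟨Integrable.of_eval fun i => (h i).1, Integrable.of_eval fun i => (h i).2⟩
  exact ((ContinuousLinearMap.proj (R := ℝ) (φ := fun _ : p => ℝ) i).intervalIntegral_comp_comm
    h').symm

/-- The entries of `piFun`, as integrals over the whole interval. -/
theorem piFun_apply {R0 : ℝ → Matrix p q ℝ} {R1 R2 : ℝ → ℝ → Matrix p q ℝ} {v : ℝ → q → ℝ} {s : ℝ}
    (hs : s ∈ Icc a b)
    (h : ∀ i j, Integrable (fun θ => triKernel R1 R2 s θ i j * v θ j) (mu a b)) (i : p) :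
    piFun a b R0 R1 R2 v s i =
      ∑ j, (R0 s i j * v s j + ∫ θ, triKernel R1 R2 s θ i j * v θ j ∂(mu a b)) := by
  have hab := hs.1.trans hs.2
  have ha : a ∈ Icc a b := ⟨le_rfl, hab⟩
  have hb : b ∈ Icc a b := ⟨hab, le_rfl⟩
  have k1 (i : p) (j : q) : EqOn (fun θ => triKernel R1 R2 s θ i j * v θ j)
      (fun θ => R1 s θ i j * v θ j) (uIoc a s) := by
    intro θ hθ
    rw [uIoc_of_le hs.1] at hθ
    simp [triKernel, hθ.2]
  have k2 (i : p) (j : q) : EqOn (fun θ => triKernel R1 R2 s θ i j * v θ j)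
      (fun θ => R2 s θ i j * v θ j) (uIoc s b) := by
    intro θ hθ
    rw [uIoc_of_le hs.2] at hθ
    simp [triKernel, not_le.2 hθ.1]
  have h1 (i : p) (j : q) : IntervalIntegrable (fun θ => R1 s θ i j * v θ j) volume a s :=
    (intervalIntegrable_of_integrable (h i j) ha hs).congr (k1 i j)
  have h2 (i : p) (j : q) : IntervalIntegrable (fun θ => R2 s θ i j * v θ j) volume s b :=
    (intervalIntegrable_of_integrable (h i j) hs hb).congr (k2 i j)
  have e1 : (∫ θ in a..s, R1 s θ *ᵥ v θ) i = ∑ j, ∫ θ in a..s, R1 s θ i j * v θ j := by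
    rw [intervalIntegral_pi_apply (F := fun θ => R1 s θ *ᵥ v θ) fun i =>
      intervalIntegrable_finsetSum _ fun j _ => h1 i j]
    exact intervalIntegral.integral_finsetSum fun j _ => h1 i j
  have e2 : (∫ θ in s..b, R2 s θ *ᵥ v θ) i = ∑ j, ∫ θ in s..b, R2 s θ i j * v θ j := by
    rw [intervalIntegral_pi_apply (F := fun θ => R2 s θ *ᵥ v θ) fun i =>
      intervalIntegrable_finsetSum _ fun j _ => h2 i j]
    exact intervalIntegral.integral_finsetSum fun j _ => h2 i j
  have e3 (j : q) : ∫ θ, triKernel R1 R2 s θ i j * v θ j ∂(mu a b) =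
      (∫ θ in a..s, R1 s θ i j * v θ j) + ∫ θ in s..b, R2 s θ i j * v θ j := by
    rw [← intervalIntegral.integral_congr_ae (.of_forall fun θ hθ => k1 i j hθ),
      ← intervalIntegral.integral_congr_ae (.of_forall fun θ hθ => k2 i j hθ),
      intervalIntegral.integral_add_adjacent_intervals
        (intervalIntegrable_of_integrable (h i j) ha hs)
        (intervalIntegrable_of_integrable (h i j) hs hb), intervalIntegral_eq_integral_mu hab]
  simp only [piFun, Pi.add_apply, e1, e2, e3, Finset.sum_add_distrib, Matrix.mulVec, dotProduct]
  ring

theorem memLp_coord (v : L2 a b q) (j : q) : MemLp (fun θ => v θ j) 2 (mu a b) :=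
  (Lp.memLp v).eval_piLp j

theorem piFun_apply_ae {R0 : ℝ → Matrix p q ℝ} {R1 R2 : ℝ → ℝ → Matrix p q ℝ}
    (h1 : KernelL2 a b R1) (h2 : KernelL2 a b R2) {v : ℝ → q → ℝ}
    (hv : ∀ j, MemLp (fun θ => v θ j) 2 (mu a b)) : ∀ᵐ s ∂(mu a b), ∀ i,
      piFun a b R0 R1 R2 v s i =
        ∑ j, (R0 s i j * v s j + ∫ θ, triKernel R1 R2 s θ i j * v θ j ∂(mu a b)) := by
  filter_upwards [(h1.triKernel h2).slice_ae, ae_mem_Icc] with s k hs i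
  exact piFun_apply hs (fun i j => (k i j).integrable_mul (hv j)) i

/-- An essentially bounded multiplier and square-integrable kernels define a bounded operator. -/
theorem exists_isPI {R0 : ℝ → Matrix p q ℝ} {R1 R2 : ℝ → ℝ → Matrix p q ℝ}
    (h0 : MatMemLp a b ⊤ R0) (h1 : KernelL2 a b R1) (h2 : KernelL2 a b R2) :
    ∃ P : L2 a b q →L[ℝ] L2 a b p, IsPI P R0 R1 R2 := by
  choose M hM using fun i j => exists_clm_mul (h0 i j)
  choose N hN using fun i j => exists_clm_integral_kernel (h1.triKernel h2 i j)
  obtain ⟨P, hP⟩ := exists_clm_of_entries fun i j => M i j + N i j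
  refine ⟨P, fun v => ?_⟩
  have hc : ∀ᵐ s ∂(mu a b), ∀ j,
      coordL2 (mu a b) j v s = v s j :=
    ae_all_iff.2 fun j => ContinuousLinearMap.coeFn_compLpL _ _
  have hA : ∀ᵐ s ∂(mu a b), ∀ i j, (M i j + N i j)
      (coordL2 (mu a b) j v) s =
        R0 s i j * v s j + ∫ θ, PIE.triKernel R1 R2 s θ i j * v θ j ∂(mu a b) := by
    refine ae_all_iff.2 fun i => ae_all_iff.2 fun j => ?_
    set w := coordL2 (mu a b) j v
    rw [add_apply]
    filter_upwards [Lp.coeFn_add (M i j w) (N i j w), hM i j w, hN i j w, hc] with s e1 e2 e3 e4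
    rw [e1, Pi.add_apply, e2, e3, e4]
    congr 1
    refine integral_congr_ae ?_
    filter_upwards [hc] with θ hθ
    rw [hθ]
  filter_upwards [hP v, hA, piFun_apply_ae (R0 := R0) h1 h2 (memLp_coord v)] with s e1 e2 e3
  ext i
  rw [e1, e3]
  exact Finset.sum_congr rfl fun j _ => e2 i j

end Triangular

/-! ### Integrals of matrix-valued functions -/

section MatrixIntegral

variable {p q r : Type} {a b : ℝ}

theorem integrable_mulVec [Fintype p] [Fintype q] {F : ℝ → Matrix p q ℝ} {v : ℝ → q → ℝ}
    (h : ∀ i j, Integrable (fun s => F s i j * v s j) (mu a b)) :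
    Integrable (fun s => F s *ᵥ v s) (mu a b) :=
  Integrable.of_eval fun i => integrable_finsetSum _ fun j _ => h i j

theorem MatMemLp.integrable_mulVec [Fintype p] [Fintype q] {F : ℝ → Matrix p q ℝ} {v : ℝ → q → ℝ}
    (h : MatMemLp a b 2 F) (hv : ∀ j, MemLp (fun s => v s j) 2 (mu a b)) :
    Integrable (fun s => F s *ᵥ v s) (mu a b) :=
  PIE.integrable_mulVec fun i j => (h i j).integrable_mul (hv j)

theorem mulVec_intervalIntegral [Fintype p] [Fintype q] (M : Matrix p q ℝ) {F : ℝ → q → ℝ}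
    {c d : ℝ} (hF : IntervalIntegrable F volume c d) :
    M *ᵥ (∫ s in c..d, F s) = ∫ s in c..d, M *ᵥ F s :=
  ((LinearMap.toContinuousLinearMap M.mulVecLin).intervalIntegral_comp_comm hF).symm

theorem matInt_mulVec [Fintype p] [Fintype q] {F : ℝ → Matrix p q ℝ} {c d : ℝ}
    (hF : ∀ i j, IntervalIntegrable (fun s => F s i j) volume c d) (w : q → ℝ) :
    matInt c d F *ᵥ w = ∫ s in c..d, F s *ᵥ w := by
  ext i
  rw [intervalIntegral_pi_apply]
  · simp only [Matrix.mulVec, dotProduct, matInt, Matrix.of_apply]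
    rw [intervalIntegral.integral_finsetSum fun j _ => (hF i j).mul_const _]
    simp
  · intro i
    simp only [Matrix.mulVec, dotProduct]
    exact intervalIntegrable_finsetSum _ fun j _ => (hF i j).mul_const _

theorem MatMemLp.const (M : Matrix p q ℝ) (t : ℝ≥0∞) : MatMemLp a b t fun _ => M :=
  fun _ _ => memLp_const _

theorem MatMemLp.add {t : ℝ≥0∞} {F H : ℝ → Matrix p q ℝ} (hF : MatMemLp a b t F)
    (hH : MatMemLp a b t H) : MatMemLp a b t fun s => F s + H s :=
  fun i j => (hF i j).add (hH i j)

theorem MatMemLp.sub {t : ℝ≥0∞} {F H : ℝ → Matrix p q ℝ} (hF : MatMemLp a b t F)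
    (hH : MatMemLp a b t H) : MatMemLp a b t fun s => F s - H s :=
  fun i j => (hF i j).sub (hH i j)

theorem MatMemLp.mul [Fintype q] {t : ℝ≥0∞} {F : ℝ → Matrix p q ℝ} {H : ℝ → Matrix q r ℝ}
    (hF : MatMemLp a b t F) (hH : MatMemLp a b ⊤ H) : MatMemLp a b t fun s => F s * H s :=
  fun i j => memLp_finsetSum _ fun k _ => (hH k j).mul (hF i k)

theorem MatMemLp.mul' [Fintype q] {t : ℝ≥0∞} {F : ℝ → Matrix p q ℝ} {H : ℝ → Matrix q r ℝ}
    (hF : MatMemLp a b ⊤ F) (hH : MatMemLp a b t H) : MatMemLp a b t fun s => F s * H s :=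
  fun i j => memLp_finsetSum _ fun k _ => (hH k j).mul (hF i k)

theorem memLp_of_continuousOn {f : ℝ → ℝ} (hf : ContinuousOn f (Icc a b)) (t : ℝ≥0∞) :
    MemLp f t (mu a b) := by
  obtain ⟨C, hC⟩ := isCompact_Icc.exists_bound_of_continuousOn hf
  refine (memLp_top_of_bound (hf.aestronglyMeasurable measurableSet_Icc) C ?_).mono_exponent le_top
  filter_upwards [ae_mem_Icc] with s hs using hC s hs

theorem MatMemLp.of_continuous {F : ℝ → Matrix p q ℝ} (hF : ∀ i j, Continuous fun s => F s i j)
    (t : ℝ≥0∞) : MatMemLp a b t F :=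
  fun i j => memLp_of_continuousOn (hF i j).continuousOn t

end MatrixIntegral

/-! ### The matrices `T`, `Q`, `U₁`, `U₂` -/

section Matrices

variable {n₀ n₁ n₂ : ℕ}

/-- The matrix `E` with `E col(x₁, x₂, ∂ₛx₂) = col(0, x₁, x₂)`. -/
def embC (n₀ n₁ n₂ : ℕ) : Matrix (IX n₀ n₁ n₂) (IC n₁ n₂) ℝ :=
  Matrix.fromRows 0 (Matrix.fromCols 1 0)

theorem Tmat_mulVec (s : ℝ) (y : IC n₁ n₂ → ℝ) : Tmat n₁ n₂ s *ᵥ y =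
    Sum.elim (Sum.elim (fun i => y (.inl (.inl i))) (fun j => y (.inl (.inr j)) + s * y (.inr j)))
      (fun j => y (.inr j)) := by
  ext ((i | j) | j) <;> simp [Tmat, T1, Matrix.fromRows_mulVec, Matrix.fromBlocks_mulVec,
    Matrix.smul_mulVec]

theorem Qmat_mulVec (s : ℝ) (v : IX n₀ n₁ n₂ → ℝ) : Qmat n₀ n₁ n₂ s *ᵥ v =
    Sum.elim (Sum.elim (fun i => v (.inr (.inl i))) (fun j => s * v (.inr (.inr j))))
      (fun j => v (.inr (.inr j))) := by
  ext ((i | j) | j) <;> simp [Qmat, Q1, Matrix.fromCols_mulVec,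
    Matrix.fromBlocks_mulVec, Matrix.smul_mulVec]

theorem U1_mulVec (v : IX n₀ n₁ n₂ → ℝ) : U1 n₀ n₁ n₂ *ᵥ v =
    Sum.elim (Sum.elim (fun i => v (.inl i)) (0 : Fin n₁ ⊕ Fin n₂ → ℝ))
      (Sum.elim (Sum.elim (fun i => v (.inr (.inl i))) (0 : Fin n₂ → ℝ)) (fun j => v (.inr (.inr j)))) := by
  ext ((i | (i | i)) | ((i | i) | i)) <;>
    simp [U1, Matrix.fromRows_mulVec, Matrix.fromBlocks_mulVec]

theorem U2_mulVec (y : IC n₁ n₂ → ℝ) : U2 n₀ n₁ n₂ *ᵥ y =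
    Sum.elim (Sum.elim (0 : Fin n₀ → ℝ) (fun i => y (.inl i)))
      (Sum.elim (Sum.elim (0 : Fin n₁ → ℝ) (fun j => y (.inr j))) (0 : Fin n₂ → ℝ)) := by
  ext ((i | (i | i)) | ((i | i) | i)) <;>
    simp [U2, Matrix.fromRows_mulVec, Matrix.fromBlocks_mulVec]

theorem G0_mulVec (s : ℝ) (v : IX n₀ n₁ n₂ → ℝ) :
    G0 n₀ n₁ n₂ s *ᵥ v = Sum.elim (fun i => v (.inl i)) (0 : Fin n₁ ⊕ Fin n₂ → ℝ) := by
  ext (i | i) <;> simp [G0, Matrix.fromBlocks_mulVec]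

theorem embC_mulVec (y : IC n₁ n₂ → ℝ) :
    embC n₀ n₁ n₂ *ᵥ y = Sum.elim (0 : Fin n₀ → ℝ) (fun i => y (.inl i)) := by
  ext (i | i) <;> simp [embC, Matrix.fromRows_mulVec, Matrix.fromCols_mulVec]

theorem embC_mul_Tmat (s : ℝ) : embC n₀ n₁ n₂ * Tmat n₁ n₂ s = Matrix.fromRows 0 (T1 n₁ n₂ s) := by
  simp [embC, Tmat, Matrix.fromRows_mul, Matrix.fromCols_mul_fromRows]

theorem embC_mul_Qmat (s : ℝ) :
    embC n₀ n₁ n₂ * Qmat n₀ n₁ n₂ s = Matrix.fromRows 0 (Q1 n₀ n₁ n₂ s) := by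
  simp [embC, Qmat, Matrix.fromRows_mul, Matrix.fromCols_mul_fromRows]

theorem Tmat_apply (s : ℝ) (k l : IC n₁ n₂) :
    Tmat n₁ n₂ s k l = Tmat n₁ n₂ 0 k l + s * (Tmat n₁ n₂ 1 - Tmat n₁ n₂ 0) k l := by
  rcases k with ((k | k) | k) <;> rcases l with ((l | l) | l) <;> simp [Tmat, T1, Matrix.one_apply]

theorem Qmat_apply (s : ℝ) (k : IC n₁ n₂) (l : IX n₀ n₁ n₂) : Qmat n₀ n₁ n₂ s k l =
    Qmat n₀ n₁ n₂ 0 k l + s * (Qmat n₀ n₁ n₂ 1 - Qmat n₀ n₁ n₂ 0) k l := by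
  rcases k with ((k | k) | k) <;> rcases l with (l | (l | l)) <;> simp [Qmat, Q1, Matrix.one_apply]

theorem continuous_Tmat (k l : IC n₁ n₂) : Continuous fun s => Tmat n₁ n₂ s k l := by
  rw [funext fun s => Tmat_apply s k l]
  fun_prop

theorem continuous_Qmat (k : IC n₁ n₂) (l : IX n₀ n₁ n₂) :
    Continuous fun s => Qmat n₀ n₁ n₂ s k l := by
  rw [funext fun s => Qmat_apply s k l]
  fun_prop

/-- `x_D = U₁ 𝒟x + U₂ x_c`. -/
theorem xD_eq {a b : ℝ} (x : L2 a b (IX n₀ n₁ n₂)) (s : ℝ) :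
    xD x s = U1 n₀ n₁ n₂ *ᵥ (dFun x s).ofLp + U2 n₀ n₁ n₂ *ᵥ xC x s := by
  rw [U1_mulVec, U2_mulVec]
  ext ((i | (i | i)) | ((i | i) | i)) <;> simp [xD, dFun, xC, st1, st2]

/-- `x` consists of the first block of `𝒟x` and the first two blocks of `x_c`. -/
theorem ofLp_eq {a b : ℝ} (x : L2 a b (IX n₀ n₁ n₂)) (s : ℝ) :
    (x s).ofLp = G0 n₀ n₁ n₂ s *ᵥ (dFun x s).ofLp + embC n₀ n₁ n₂ *ᵥ xC x s := by
  rw [G0_mulVec, embC_mulVec]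
  ext (i | (i | i)) <;> simp [dFun, xC, st1, st2]

end Matrices

/-! ### Reconstruction of the state from its highest derivatives -/

section Reconstruction

variable {a b : ℝ} {n₀ n₁ n₂ m : ℕ}

/-- The Taylor formula `T(s-a) y + ∫ₐˢ Q(s-θ) v(θ) dθ`, which gives `x_c(s)` from `y = x_c(a)` and
`v = 𝒟x`. -/
noncomputable def taylor (a : ℝ) (y : IC n₁ n₂ → ℝ) (v : ℝ → IX n₀ n₁ n₂ → ℝ) (s : ℝ) :
    IC n₁ n₂ → ℝ :=
  Tmat n₁ n₂ (s - a) *ᵥ y + ∫ θ in a..s, Qmat n₀ n₁ n₂ (s - θ) *ᵥ v θ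

/-- Cauchy's formula for a repeated primitive. -/
theorem integral_primitive_eq {c : ℝ} (hc : c ∈ Icc a b) {g : ℝ → ℝ}
    (hg : Integrable g (mu a b)) :
    ∫ r in a..c, (∫ θ in a..r, g θ) = ∫ θ in a..c, (c - θ) * g θ := by
  have hg' : Integrable g (mu a c) := IntegrableOn.mono_set hg (Icc_subset_Icc le_rfl hc.2)
  have := integral_triangle_swap hc.1 (H := fun _ θ => g θ) (by
    have := (integrable_of_continuous (a := a) (b := c) (continuous_const (y := (1 : ℝ)))).mul_prod
      hg'
    simpa [Function.uncurry_def] using this)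
  rw [this]
  simp

theorem integrable_Qmat_mulVec {v : ℝ → IX n₀ n₁ n₂ → ℝ}
    (hv : ∀ j, Integrable (fun θ => v θ j) (mu a b)) (s : ℝ) :
    Integrable (fun θ => Qmat n₀ n₁ n₂ (s - θ) *ᵥ v θ) (mu a b) := by
  refine integrable_mulVec fun k j => ?_
  have := integrable_mul_of_continuous (hv j)
    ((continuous_Qmat k j).comp (continuous_const (y := s) |>.sub continuous_id))
  simpa [mul_comm] using this

theorem taylor_apply {v : ℝ → IX n₀ n₁ n₂ → ℝ} (hv : ∀ j, Integrable (fun θ => v θ j) (mu a b))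
    (y : IC n₁ n₂ → ℝ) {s : ℝ} (hs : s ∈ Icc a b) : taylor a y v s =
      Sum.elim (Sum.elim (fun i => y (.inl (.inl i)) + ∫ θ in a..s, v θ (.inr (.inl i)))
        (fun j => y (.inl (.inr j)) +
          ∫ r in a..s, (y (.inr j) + ∫ θ in a..r, v θ (.inr (.inr j)))))
        (fun j => y (.inr j) + ∫ θ in a..s, v θ (.inr (.inr j))) := by
  have ha : a ∈ Icc a b := ⟨le_rfl, hs.1.trans hs.2⟩
  have hI (k : IC n₁ n₂) : (∫ θ in a..s, Qmat n₀ n₁ n₂ (s - θ) *ᵥ v θ) k =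
      ∫ θ in a..s, (Qmat n₀ n₁ n₂ (s - θ) *ᵥ v θ) k :=
    intervalIntegral_pi_apply (fun i => intervalIntegrable_of_integrable
      ((integrable_Qmat_mulVec hv s).eval i) ha hs) k
  ext ((i | j) | j)
  · simp only [taylor, Pi.add_apply, hI]
    simp [Tmat_mulVec, Qmat_mulVec]
  · simp only [taylor, Pi.add_apply, hI]
    simp only [Tmat_mulVec, Qmat_mulVec, Sum.elim_inl, Sum.elim_inr]
    rw [intervalIntegral.integral_add intervalIntegrable_const, integral_primitive_eq hs (hv _)]
    · simp
      ring
    · have := continuousOn_primitive (hs.1.trans hs.2) (hv (.inr (.inr j)))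
      exact (this.mono (by rw [uIcc_of_le hs.1]; exact Icc_subset_Icc le_rfl hs.2)).intervalIntegrable
  · simp only [taylor, Pi.add_apply, hI]
    simp [Tmat_mulVec, Qmat_mulVec]

theorem continuousOn_taylor (hab : a < b) {v : ℝ → IX n₀ n₁ n₂ → ℝ}
    (hv : ∀ j, Integrable (fun θ => v θ j) (mu a b)) (y : IC n₁ n₂ → ℝ) :
    ContinuousOn (taylor a y v) (Icc a b) := by
  refine ContinuousOn.congr ?_ fun s hs => taylor_apply hv y hs
  have hc (c : ℝ) (j : IX n₀ n₁ n₂) : ContinuousOn (fun s => c + ∫ θ in a..s, v θ j) (Icc a b) :=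
    continuousOn_const.add (continuousOn_primitive hab.le (hv j))
  refine continuousOn_pi.2 ?_
  rintro ((i | j) | j)
  · exact hc _ _
  · exact continuousOn_const.add (continuousOn_primitive hab.le (hc _ _).integrableOn_Icc)
  · exact hc _ _

theorem D_coeFn (x : L2 a b (IX n₀ n₁ n₂)) : D x =ᵐ[mu a b] dFun x := (memLp_dFun x).coeFn_toLp

theorem integrable_coord {q : Type} [Fintype q] (v : L2 a b q) (j : q) :
    Integrable (fun θ => v θ j) (mu a b) := integrable_of_memLp_two (memLp_coord v j)

theorem intervalIntegral_congr_mu {E : Type*} [NormedAddCommGroup E] [NormedSpace ℝ E]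
    {f g : ℝ → E} {c d : ℝ} (hc : c ∈ Icc a b)
    (hd : d ∈ Icc a b) (h : f =ᵐ[mu a b] g) : ∫ s in c..d, f s = ∫ s in c..d, g s := by
  refine intervalIntegral.integral_congr_ae ?_
  have h' := (ae_restrict_iff' measurableSet_Icc).1 h
  filter_upwards [h'] with s hs hsm
  exact hs (uIcc_subset_Icc hc hd (uIoc_subset_uIcc hsm))

/-- Functions in `Wⁿ` satisfy the Taylor formula. -/
theorem MemW.exists_xC_ae_eq_taylor (hab : a < b) {x : L2 a b (IX n₀ n₁ n₂)} (hx : MemW x) :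
    ∃ y : IC n₁ n₂ → ℝ, xC x =ᵐ[mu a b] taylor a y fun s => (D x s).ofLp := by
  choose y1 h1 using fun i => exists_ae_eq_primitive hab (integrable_coord x (.inr (.inl i))) (hx.1 i)
  choose y2 h2 using fun j =>
    exists_ae_eq_primitive hab (integrable_coord x (.inr (.inr j))) (hx.2 j).1
  choose y3 h3 using fun j => exists_ae_eq_primitive hab
    (integrable_of_memLp_two (Lp.memLp (wderiv a b (st2 x j)))) (hx.2 j).2
  have ha : a ∈ Icc a b := ⟨le_rfl, hab.le⟩
  refine ⟨Sum.elim (Sum.elim y1 y2) y3, ?_⟩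
  filter_upwards [ae_all_iff.2 h1, ae_all_iff.2 h2, ae_all_iff.2 h3, ae_mem_Icc]
    with s e1 e2 e3 hs
  rw [taylor_apply (fun j => integrable_coord (D x) j) _ hs]
  have d1 (i : Fin n₁) : (fun θ => D x θ (.inr (.inl i))) =ᵐ[mu a b] wderiv a b (st1 x i) := by
    filter_upwards [D_coeFn x] with θ hθ
    simp [hθ, dFun]
  have d2 (j : Fin n₂) : (fun θ => D x θ (.inr (.inr j))) =ᵐ[mu a b]
      wderiv a b (wderiv a b (st2 x j)) := by
    filter_upwards [D_coeFn x] with θ hθ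
    simp [hθ, dFun]
  have d3 (j : Fin n₂) : (fun r => y3 j + ∫ θ in a..r, D x θ (.inr (.inr j))) =ᵐ[mu a b]
      wderiv a b (st2 x j) := by
    filter_upwards [h3 j, ae_mem_Icc] with r hr hr'
    rw [hr, intervalIntegral_congr_mu ha hr' (d2 j)]
  ext ((i | j) | j)
  · simp only [xC, Sum.elim_inl]
    rw [intervalIntegral_congr_mu ha hs (d1 i)]
    exact e1 i
  · simp only [xC, Sum.elim_inl, Sum.elim_inr]
    rw [intervalIntegral_congr_mu ha hs (d3 j)]
    exact e2 j
  · simp only [xC, Sum.elim_inr]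
    rw [intervalIntegral_congr_mu ha hs (d2 j)]
    exact e3 j

/-- Conversely, a function given by the Taylor formula belongs to `Wⁿ`, and its highest derivatives
are those prescribed. -/
theorem memW_of_ae_eq_taylor (hab : a < b) {x v : L2 a b (IX n₀ n₁ n₂)} {y : IC n₁ n₂ → ℝ}
    (hx : ∀ᵐ s ∂(mu a b), (x s).ofLp =
      G0 n₀ n₁ n₂ s *ᵥ (v s).ofLp + embC n₀ n₁ n₂ *ᵥ taylor a y (fun s => (v s).ofLp) s) :
    MemW x ∧ D x = v ∧ xC x =ᵐ[mu a b] taylor a y fun s => (v s).ofLp := by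
  have hv := fun j => integrable_coord v j
  have hx' : ∀ᵐ s ∂(mu a b), (∀ i, x s (.inl i) = v s (.inl i)) ∧
      (∀ i, st1 x i s = y (.inl (.inl i)) + ∫ θ in a..s, v θ (.inr (.inl i))) ∧
      ∀ j, st2 x j s = y (.inl (.inr j)) +
          ∫ r in a..s, (y (.inr j) + ∫ θ in a..r, v θ (.inr (.inr j))) := by
    filter_upwards [hx, ae_mem_Icc] with s hs hs'
    rw [taylor_apply hv y hs', G0_mulVec, embC_mulVec] at hs
    refine ⟨fun i => ?_, fun i => ?_, fun j => ?_⟩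
    · rw [hs]; simp
    · rw [st1, hs]; simp
    · rw [st2, hs]; simp
  have w1 (i : Fin n₁) := hasL2Deriv_of_ae_eq_primitive hab (memLp_coord v (.inr (.inl i)))
    (hx'.mono fun s hs => hs.2.1 i)
  have w2 (j : Fin n₂) := hasL2Deriv_of_ae_eq_primitive hab
    (memLp_of_continuousOn (continuousOn_const.add (continuousOn_primitive hab.le (hv _))) 2)
    (hx'.mono fun s hs => hs.2.2 j)
  have w3 (j : Fin n₂) := hasL2Deriv_of_ae_eq_primitive hab (memLp_coord v (.inr (.inr j)))
    (w2 j).2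
  refine ⟨⟨fun i => (w1 i).1, fun j => ⟨(w2 j).1, (w3 j).1⟩⟩, ?_, ?_⟩
  · refine Lp.ext ?_
    filter_upwards [D_coeFn x, hx', ae_all_iff.2 fun i => (w1 i).2, ae_all_iff.2 fun j => (w3 j).2]
      with s e0 e1 e2 e3
    rw [e0]
    ext (i | (i | j))
    · exact e1.1 i
    · exact e2 i
    · exact e3 j
  · filter_upwards [hx', ae_mem_Icc, ae_all_iff.2 fun j => (w2 j).2] with s e1 hs e2
    rw [taylor_apply hv y hs]
    ext ((i | j) | j)
    · exact e1.2.1 i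
    · exact e1.2.2 j
    · exact e2 j

end Reconstruction

/-! ### The boundary conditions -/

section Boundary

variable {a b : ℝ} {n₀ n₁ n₂ m : ℕ}

theorem matMemLp_Tmat (c : ℝ) (t : ℝ≥0∞) : MatMemLp a b t fun s => Tmat n₁ n₂ (s - c) :=
  .of_continuous (fun k l => (continuous_Tmat k l).comp (continuous_id.sub continuous_const)) t

theorem continuousOn_primitive_right (hab : a < b) {g : ℝ → ℝ} (hg : Integrable g (mu a b)) :
    ContinuousOn (fun s => ∫ θ in s..b, g θ) (Icc a b) := by
  have ha : a ∈ Icc a b := ⟨le_rfl, hab.le⟩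
  have hb : b ∈ Icc a b := ⟨hab.le, le_rfl⟩
  refine (continuousOn_const (c := ∫ θ in a..b, g θ)).sub (continuousOn_primitive hab.le hg)
    |>.congr fun s hs => ?_
  have := intervalIntegral.integral_add_adjacent_intervals
    (intervalIntegrable_of_integrable hg ha hs) (intervalIntegrable_of_integrable hg hs hb)
  change _ = (∫ θ in a..b, g θ) - ∫ θ in a..s, g θ
  rw [← this, add_sub_cancel_left]

theorem integrable_mul_Qmat {F : ℝ → ℝ} (hF : Integrable F (mu a b)) (c : ℝ)
    (k : IC n₁ n₂) (j : IX n₀ n₁ n₂) :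
    Integrable (fun θ => F θ * Qmat n₀ n₁ n₂ (θ - c) k j) (mu a b) :=
  integrable_mul_of_continuous hF ((continuous_Qmat k j).comp (continuous_id.sub continuous_const))

theorem continuousOn_matInt_mul_Qmat (hab : a < b) {p : Type} {F : ℝ → Matrix p (IC n₁ n₂) ℝ}
    (hF : ∀ i k, Integrable (fun s => F s i k) (mu a b)) (i : p) (j : IX n₀ n₁ n₂) :
    ContinuousOn (fun s => matInt s b (fun θ => F θ * Qmat n₀ n₁ n₂ (θ - s)) i j) (Icc a b) := by
  have hb : b ∈ Icc a b := ⟨hab.le, le_rfl⟩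
  -- `Q` is affine, so the integral is a combination of primitives with continuous coefficients.
  have e : ∀ s ∈ Icc a b, matInt s b (fun θ => F θ * Qmat n₀ n₁ n₂ (θ - s)) i j =
      ∑ k, ((∫ θ in s..b, F θ i k) * Qmat n₀ n₁ n₂ (0 - s) k j + (∫ θ in s..b, F θ i k * θ) *
        (Qmat n₀ n₁ n₂ 1 - Qmat n₀ n₁ n₂ 0) k j) := by
    intro s hs
    simp only [matInt, Matrix.of_apply, Matrix.mul_apply]
    rw [intervalIntegral.integral_finsetSum fun k _ =>
      intervalIntegrable_of_integrable (integrable_mul_Qmat (hF i k) s k j) hs hb]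
    refine Finset.sum_congr rfl fun k _ => ?_
    rw [← intervalIntegral.integral_mul_const, ← intervalIntegral.integral_mul_const,
      ← intervalIntegral.integral_add]
    · refine intervalIntegral.integral_congr fun θ _ => ?_
      rw [Qmat_apply (θ - s), Qmat_apply (0 - s)]
      ring
    · exact (intervalIntegrable_of_integrable (hF i k) hs hb).mul_const _
    · exact (intervalIntegrable_of_integrable
        (integrable_mul_of_continuous (hF i k) continuous_id) hs hb).mul_const _
  refine ContinuousOn.congr ?_ e
  refine continuousOn_finsetSum _ fun k _ => ?_
  exact ((continuousOn_primitive_right hab (hF i k)).mul ((continuous_Qmat k j).comp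
    (continuous_const.sub continuous_id)).continuousOn).add
    ((continuousOn_primitive_right hab
      (integrable_mul_of_continuous (hF i k) continuous_id)).mul continuousOn_const)

/-- The matrix `Λ` with `B_Q = B_T⁻¹ Λ`. -/
noncomputable def BQcore (b : ℝ) (G : BoundaryParams n₀ n₁ n₂ m) (s : ℝ) :
    Matrix (Fin m) (IX n₀ n₁ n₂) ℝ :=
  G.BI s * U1 n₀ n₁ n₂ - G.B * Matrix.fromRows 0 (Qmat n₀ n₁ n₂ (b - s)) +
    matInt s b (fun θ => G.BI θ * U2 n₀ n₁ n₂ * Qmat n₀ n₁ n₂ (θ - s))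

theorem MatMemLp.integrable {p q : Type} {F : ℝ → Matrix p q ℝ} (hF : MatMemLp a b 2 F) (i : p)
    (j : q) : Integrable (fun s => F s i j) (mu a b) := integrable_of_memLp_two (hF i j)

theorem MatMemLp.two_of_two_le {p q : Type} {t : ℝ≥0∞} {F : ℝ → Matrix p q ℝ}
    (hF : MatMemLp a b t F) (ht : 2 ≤ t) : MatMemLp a b 2 F :=
  fun i j => (hF i j).mono_exponent ht

theorem matMemLp_fromRows_Qmat (t : ℝ≥0∞) : MatMemLp a b t fun s =>
    Matrix.fromRows (0 : Matrix (IC n₁ n₂) _ ℝ) (Qmat n₀ n₁ n₂ (b - s)) := by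
  refine .of_continuous (fun k j => ?_) t
  rcases k with k | k
  · exact continuous_const
  · exact (continuous_Qmat k j).comp (continuous_const.sub continuous_id)

theorem matMemLp_BQcore (hab : a < b) (G : BoundaryParams n₀ n₁ n₂ m) {t : ℝ≥0∞} (ht : 2 ≤ t)
    (hBI : MatMemLp a b t G.BI) : MatMemLp a b t (BQcore b G) := by
  have h2 : MatMemLp a b 2 fun s => G.BI s * U2 n₀ n₁ n₂ :=
    (hBI.two_of_two_le ht).mul (.const _ _)
  refine ((hBI.mul (.const _ _)).sub ((MatMemLp.const _ _).mul' (matMemLp_fromRows_Qmat t))).add ?_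
  exact fun i j => memLp_of_continuousOn
    (continuousOn_matInt_mul_Qmat hab (fun i k => h2.integrable i k) i j) t

theorem matMemLp_BQ (hab : a < b) (G : BoundaryParams n₀ n₁ n₂ m) {t : ℝ≥0∞} (ht : 2 ≤ t)
    (hBI : MatMemLp a b t G.BI) : MatMemLp a b t (BQ a b G) :=
  (MatMemLp.const _ _).mul' (matMemLp_BQcore hab G ht hBI)

theorem matInv_spec {p q : Type} [Fintype p] [Fintype q] [DecidableEq p] [DecidableEq q]
    {M : Matrix p q ℝ} (h : IsInvertible M) : M * matInv M = 1 ∧ matInv M * M = 1 := by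
  rw [matInv, dif_pos h]
  exact h.choose_spec

/-- Interchange of integrals for a matrix-valued function and the convolution with `Q`. -/
theorem integral_mulVec_Qmat_swap (hab : a < b) {p : Type} [Fintype p]
    {F : ℝ → Matrix p (IC n₁ n₂) ℝ} (hF : MatMemLp a b 2 F) {v : ℝ → IX n₀ n₁ n₂ → ℝ}
    (hv : ∀ j, Integrable (fun θ => v θ j) (mu a b)) :
    ∫ s in a..b, F s *ᵥ (∫ θ in a..s, Qmat n₀ n₁ n₂ (s - θ) *ᵥ v θ) =
      ∫ θ in a..b, matInt θ b (fun s => F s * Qmat n₀ n₁ n₂ (s - θ)) *ᵥ v θ := by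
  have ha : a ∈ Icc a b := ⟨le_rfl, hab.le⟩
  have hb : b ∈ Icc a b := ⟨hab.le, le_rfl⟩
  have hint : Integrable (Function.uncurry fun s θ => F s *ᵥ (Qmat n₀ n₁ n₂ (s - θ) *ᵥ v θ))
      ((mu a b).prod (mu a b)) := by
    refine Integrable.of_eval fun i => ?_
    simp only [Function.uncurry_def, Matrix.mulVec, dotProduct]
    refine integrable_finsetSum _ fun k _ => ?_
    simp only [Finset.mul_sum]
    refine integrable_finsetSum _ fun j _ => ?_
    have hs : Integrable (fun s => F s i k * s) (mu a b) :=
      integrable_mul_of_continuous (hF.integrable i k) continuous_id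
    have hθ : Integrable (fun θ => v θ j * θ) (mu a b) :=
      integrable_mul_of_continuous (hv j) continuous_id
    have := ((((hF.integrable i k).mul_prod (hv j)).const_mul (Qmat n₀ n₁ n₂ 0 k j))).add
      (((hs.mul_prod (hv j)).sub ((hF.integrable i k).mul_prod hθ)).const_mul
        ((Qmat n₀ n₁ n₂ 1 - Qmat n₀ n₁ n₂ 0) k j))
    refine this.congr (.of_forall fun z => ?_)
    simp only [Pi.add_apply, Pi.sub_apply]
    rw [Qmat_apply (z.1 - z.2)]
    ring
  have h1 : ∫ s in a..b, F s *ᵥ (∫ θ in a..s, Qmat n₀ n₁ n₂ (s - θ) *ᵥ v θ) =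
      ∫ s in a..b, ∫ θ in a..s, F s *ᵥ (Qmat n₀ n₁ n₂ (s - θ) *ᵥ v θ) := by
    refine intervalIntegral.integral_congr fun s hs => ?_
    rw [uIcc_of_le hab.le] at hs
    exact mulVec_intervalIntegral _
      (intervalIntegrable_of_integrable (integrable_Qmat_mulVec hv s) ha hs)
  rw [h1, integral_triangle_swap hab.le hint]
  refine intervalIntegral.integral_congr fun θ hθ => ?_
  rw [uIcc_of_le hab.le] at hθ
  simp only [Matrix.mulVec_mulVec]
  rw [matInt_mulVec]
  refine fun i j => intervalIntegrable_of_integrable ?_ hθ hb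
  simp only [Matrix.mul_apply]
  exact integrable_finsetSum _ fun k _ => integrable_mul_Qmat (hF.integrable i k) θ k j

theorem intervalIntegrable_of_memLp {p q : Type} [Fintype p] [Fintype q] (hab : a < b)
    {F : ℝ → Matrix p q ℝ} (hF : MatMemLp a b 2 F) {v : ℝ → q → ℝ}
    (hv : ∀ j, MemLp (fun s => v s j) 2 (mu a b)) :
    IntervalIntegrable (fun s => F s *ᵥ v s) volume a b :=
  intervalIntegrable_of_integrable (hF.integrable_mulVec hv) ⟨le_rfl, hab.le⟩ ⟨hab.le, le_rfl⟩

theorem integral_BQ_mulVec (hab : a < b) (G : BoundaryParams n₀ n₁ n₂ m)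
    (hBI : MatMemLp a b 2 G.BI) {v : ℝ → IX n₀ n₁ n₂ → ℝ}
    (hv : ∀ j, MemLp (fun s => v s j) 2 (mu a b)) :
    ∫ s in a..b, BQ a b G s *ᵥ v s =
      matInv (BT a b G) *ᵥ ∫ s in a..b, BQcore b G s *ᵥ v s := by
  rw [mulVec_intervalIntegral _
    (intervalIntegrable_of_memLp hab (matMemLp_BQcore hab G le_rfl hBI) hv)]
  simp only [Matrix.mulVec_mulVec]
  rfl

theorem B_mulVec_taylor (hab : a < b) (G : BoundaryParams n₀ n₁ n₂ m) {v : ℝ → IX n₀ n₁ n₂ → ℝ}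
    (hv : ∀ j, MemLp (fun s => v s j) 2 (mu a b)) (y : IC n₁ n₂ → ℝ) :
    G.B *ᵥ Sum.elim (taylor a y v a) (taylor a y v b) =
      (G.B * Matrix.fromRows (Tmat n₁ n₂ 0) (Tmat n₁ n₂ (b - a))) *ᵥ y +
        ∫ s in a..b, (G.B * Matrix.fromRows 0 (Qmat n₀ n₁ n₂ (b - s))) *ᵥ v s := by
  have ha : a ∈ Icc a b := ⟨le_rfl, hab.le⟩
  have hb : b ∈ Icc a b := ⟨hab.le, le_rfl⟩
  have hvi := fun j => integrable_of_memLp_two (hv j)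
  have e : Sum.elim (taylor a y v a) (taylor a y v b) =
      Matrix.fromRows (Tmat n₁ n₂ 0) (Tmat n₁ n₂ (b - a)) *ᵥ y +
        ∫ s in a..b, Matrix.fromRows (0 : Matrix (IC n₁ n₂) (IX n₀ n₁ n₂) ℝ)
          (Qmat n₀ n₁ n₂ (b - s)) *ᵥ v s := by
    have hi : ∀ i, IntervalIntegrable (fun s => (Matrix.fromRows
        (0 : Matrix (IC n₁ n₂) (IX n₀ n₁ n₂) ℝ) (Qmat n₀ n₁ n₂ (b - s)) *ᵥ v s) i) volume a b :=
      fun i => intervalIntegrable_of_integrable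
        (((matMemLp_fromRows_Qmat 2).integrable_mulVec hv).eval i) ha hb
    ext (k | k)
    · rw [Pi.add_apply, intervalIntegral_pi_apply hi]
      simp [taylor, Matrix.fromRows_mulVec]
    · rw [Pi.add_apply, intervalIntegral_pi_apply hi]
      simp only [Matrix.fromRows_mulVec, Sum.elim_inr, taylor, Pi.add_apply]
      rw [intervalIntegral_pi_apply fun k => intervalIntegrable_of_integrable
        ((integrable_Qmat_mulVec hvi b).eval k) ha hb]
  rw [e, Matrix.mulVec_add, Matrix.mulVec_mulVec, mulVec_intervalIntegral _
    (intervalIntegrable_of_memLp hab (matMemLp_fromRows_Qmat 2) hv)]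
  congr 1
  exact intervalIntegral.integral_congr fun s _ => Matrix.mulVec_mulVec _ _ _

theorem integral_BI_mulVec_taylor (hab : a < b) (G : BoundaryParams n₀ n₁ n₂ m)
    (hBI : MatMemLp a b 2 G.BI) {v : ℝ → IX n₀ n₁ n₂ → ℝ}
    (hv : ∀ j, MemLp (fun s => v s j) 2 (mu a b)) (y : IC n₁ n₂ → ℝ) :
    ∫ s in a..b, G.BI s *ᵥ (U1 n₀ n₁ n₂ *ᵥ v s + U2 n₀ n₁ n₂ *ᵥ taylor a y v s) =
      (∫ s in a..b, (G.BI s * U1 n₀ n₁ n₂) *ᵥ v s) +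
      (matInt a b (fun s => G.BI s * U2 n₀ n₁ n₂ * Tmat n₁ n₂ (s - a)) *ᵥ y +
        ∫ s in a..b,
          matInt s b (fun θ => G.BI θ * U2 n₀ n₁ n₂ * Qmat n₀ n₁ n₂ (θ - s)) *ᵥ v s) := by
  have ha : a ∈ Icc a b := ⟨le_rfl, hab.le⟩
  have hb : b ∈ Icc a b := ⟨hab.le, le_rfl⟩
  have hvi := fun j => integrable_of_memLp_two (hv j)
  have hU2 : MatMemLp a b 2 fun s => G.BI s * U2 n₀ n₁ n₂ := hBI.mul (.const _ _)
  have hU1 : MatMemLp a b 2 fun s => G.BI s * U1 n₀ n₁ n₂ := hBI.mul (.const _ _)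
  have hT : MatMemLp a b 2 fun s => G.BI s * U2 n₀ n₁ n₂ * Tmat n₁ n₂ (s - a) :=
    hU2.mul (matMemLp_Tmat a ⊤)
  have hconv : ContinuousOn (fun s => ∫ θ in a..s, Qmat n₀ n₁ n₂ (s - θ) *ᵥ v θ) (Icc a b) := by
    have h := continuousOn_taylor hab hvi (0 : IC n₁ n₂ → ℝ)
    exact h.congr fun s _ => by simp [taylor]
  have i1 := intervalIntegrable_of_memLp hab hU1 hv
  have i2 : IntervalIntegrable (fun s => (G.BI s * U2 n₀ n₁ n₂ * Tmat n₁ n₂ (s - a)) *ᵥ y)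
      volume a b := intervalIntegrable_of_memLp hab hT fun j => memLp_const (y j)
  have i3 : IntervalIntegrable (fun s => (G.BI s * U2 n₀ n₁ n₂) *ᵥ
      ∫ θ in a..s, Qmat n₀ n₁ n₂ (s - θ) *ᵥ v θ) volume a b :=
    intervalIntegrable_of_memLp hab hU2 fun k => memLp_of_continuousOn (continuousOn_pi.1 hconv k) 2
  rw [← integral_mulVec_Qmat_swap hab hU2 hvi, matInt_mulVec
    (fun i j => intervalIntegrable_of_integrable (hT.integrable i j) ha hb),
    ← intervalIntegral.integral_add i2 i3, ← intervalIntegral.integral_add i1 (i2.add i3)]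
  refine intervalIntegral.integral_congr fun s _ => ?_
  simp only [taylor, Matrix.mulVec_add, Matrix.mulVec_mulVec, Matrix.mul_assoc]

theorem integral_BQcore_mulVec (hab : a < b) (G : BoundaryParams n₀ n₁ n₂ m)
    (hBI : MatMemLp a b 2 G.BI) {v : ℝ → IX n₀ n₁ n₂ → ℝ}
    (hv : ∀ j, MemLp (fun s => v s j) 2 (mu a b)) :
    ∫ s in a..b, BQcore b G s *ᵥ v s =
      (∫ s in a..b, (G.BI s * U1 n₀ n₁ n₂) *ᵥ v s) -
      (∫ s in a..b, (G.B * Matrix.fromRows 0 (Qmat n₀ n₁ n₂ (b - s))) *ᵥ v s) +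
        ∫ s in a..b,
          matInt s b (fun θ => G.BI θ * U2 n₀ n₁ n₂ * Qmat n₀ n₁ n₂ (θ - s)) *ᵥ v s := by
  have hU2 : MatMemLp a b 2 fun s => G.BI s * U2 n₀ n₁ n₂ := hBI.mul (.const _ _)
  have hU1 : MatMemLp a b 2 fun s => G.BI s * U1 n₀ n₁ n₂ := hBI.mul (.const _ _)
  have hQ : MatMemLp a b 2 fun s => G.B * Matrix.fromRows 0 (Qmat n₀ n₁ n₂ (b - s)) :=
    (MatMemLp.const _ _).mul' (matMemLp_fromRows_Qmat 2)
  have hM : MatMemLp a b 2 fun s =>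
      matInt s b (fun θ => G.BI θ * U2 n₀ n₁ n₂ * Qmat n₀ n₁ n₂ (θ - s)) :=
    fun i j => memLp_of_continuousOn
      (continuousOn_matInt_mul_Qmat hab (fun i k => hU2.integrable i k) i j) 2
  have i1 := intervalIntegrable_of_memLp hab hU1 hv
  have i2 := intervalIntegrable_of_memLp hab hQ hv
  have i3 := intervalIntegrable_of_memLp hab hM hv
  rw [← intervalIntegral.integral_sub i1 i2, ← intervalIntegral.integral_add (i1.sub i2) i3]
  refine intervalIntegral.integral_congr fun s _ => ?_
  simp only [BQcore, Matrix.add_mulVec, Matrix.sub_mulVec]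

/-- The boundary conditions for the function with Taylor data `y`, `v` determine `y` from `v`. -/
theorem boundary_iff (hab : a < b) (G : BoundaryParams n₀ n₁ n₂ m)
    (hBI : MatMemLp a b 2 G.BI) (hadm : Admissible a b G) {v : ℝ → IX n₀ n₁ n₂ → ℝ}
    (hv : ∀ j, MemLp (fun s => v s j) 2 (mu a b)) (y : IC n₁ n₂ → ℝ) :
    G.B *ᵥ Sum.elim (taylor a y v a) (taylor a y v b) =
        ∫ s in a..b, G.BI s *ᵥ (U1 n₀ n₁ n₂ *ᵥ v s + U2 n₀ n₁ n₂ *ᵥ taylor a y v s) ↔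
      y = ∫ s in a..b, BQ a b G s *ᵥ v s := by
  have key : G.B *ᵥ Sum.elim (taylor a y v a) (taylor a y v b) =
        ∫ s in a..b, G.BI s *ᵥ (U1 n₀ n₁ n₂ *ᵥ v s + U2 n₀ n₁ n₂ *ᵥ taylor a y v s) ↔
      BT a b G *ᵥ y = ∫ s in a..b, BQcore b G s *ᵥ v s := by
    rw [B_mulVec_taylor hab G hv, integral_BI_mulVec_taylor hab G hBI hv,
      integral_BQcore_mulVec hab G hBI hv, BT, Matrix.sub_mulVec, sub_eq_iff_eq_add,
      ← sub_eq_zero, ← sub_eq_zero (b := _ + matInt _ _ _ *ᵥ y)]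
    refine Eq.congr_left ?_
    abel
  obtain ⟨i1, i2⟩ := matInv_spec hadm
  rw [key, integral_BQ_mulVec hab G hBI hv]
  constructor <;> intro h
  · rw [← h, Matrix.mulVec_mulVec, i2, Matrix.one_mulVec]
  · rw [h, Matrix.mulVec_mulVec, i1, Matrix.one_mulVec]

/-- The initial Taylor data of the element of `X` with `𝒟x = v`. -/
noncomputable def bdry (a b : ℝ) (G : BoundaryParams n₀ n₁ n₂ m) (v : ℝ → IX n₀ n₁ n₂ → ℝ) :
    IC n₁ n₂ → ℝ := ∫ s in a..b, BQ a b G s *ᵥ v s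

/-- Integral operators whose kernels are built from `T`, `B_Q` and `Q` evaluate the Taylor formula
with the initial data determined by the boundary conditions. -/
theorem piFun_eq_taylor {p : Type} [Fintype p] (hab : a < b) (G : BoundaryParams n₀ n₁ n₂ m)
    (hBI : MatMemLp a b 2 G.BI) {v : ℝ → IX n₀ n₁ n₂ → ℝ}
    (hv : ∀ j, MemLp (fun s => v s j) 2 (mu a b)) (U : ℝ → Matrix p (IX n₀ n₁ n₂) ℝ)
    (K : Matrix p (IC n₁ n₂) ℝ) {s : ℝ} (hs : s ∈ Icc a b) :
    piFun a b U (fun s θ => K * Tmat n₁ n₂ (s - a) * BQ a b G θ + K * Qmat n₀ n₁ n₂ (s - θ))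
      (fun s θ => K * Tmat n₁ n₂ (s - a) * BQ a b G θ) v s =
      WithLp.toLp 2 (U s *ᵥ v s + K *ᵥ taylor a (bdry a b G v) v s) := by
  have ha : a ∈ Icc a b := ⟨le_rfl, hab.le⟩
  have hb : b ∈ Icc a b := ⟨hab.le, le_rfl⟩
  have hvi := fun j => integrable_of_memLp_two (hv j)
  have hB : Integrable (fun θ => BQ a b G θ *ᵥ v θ) (mu a b) :=
    (matMemLp_BQ hab G le_rfl hBI).integrable_mulVec hv
  have hQ := integrable_Qmat_mulVec (n₀ := n₀) (n₁ := n₁) (n₂ := n₂) hvi s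
  have hM (M : Matrix p (IC n₁ n₂) ℝ) {F : ℝ → IC n₁ n₂ → ℝ} (hF : Integrable F (mu a b)) :
      Integrable (fun θ => M *ᵥ F θ) (mu a b) :=
    (LinearMap.toContinuousLinearMap M.mulVecLin).integrable_comp hF
  rw [piFun]
  congr 1
  simp only [Matrix.add_mulVec, taylor, Matrix.mulVec_add, bdry]
  have h1 := hM (K * Tmat n₁ n₂ (s - a)) hB
  have h2 := hM K hQ
  rw [mulVec_intervalIntegral K (intervalIntegrable_of_integrable hQ ha hs), Matrix.mulVec_mulVec,
    mulVec_intervalIntegral (K * Tmat n₁ n₂ (s - a)) (intervalIntegrable_of_integrable hB ha hb),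
    ← intervalIntegral.integral_add_adjacent_intervals
      (intervalIntegrable_of_integrable h1 ha hs) (intervalIntegrable_of_integrable h1 hs hb)]
  simp only [← Matrix.mulVec_mulVec] at h1 h2 ⊢
  rw [intervalIntegral.integral_add (intervalIntegrable_of_integrable h1 ha hs)
    (intervalIntegrable_of_integrable h2 ha hs)]
  abel

end Boundary

/-! ### Separable kernels -/

section SeparableKernels

variable {p q r : Type} {a b : ℝ}

/-- Kernels that on `[a,b]²` are of the form `F(s) H(θ)`, with `F` essentially bounded and `H` with
entries in `L_t`. -/
def IsSepKernel (a b : ℝ) (t : ℝ≥0∞) (R : ℝ → ℝ → Matrix p q ℝ) : Prop :=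
  ∃ (ι : Type) (_ : Fintype ι) (F : ℝ → Matrix p ι ℝ) (H : ℝ → Matrix ι q ℝ),
    MatMemLp a b ⊤ F ∧ MatMemLp a b t H ∧ ∀ s ∈ Icc a b, ∀ θ ∈ Icc a b, R s θ = F s * H θ

theorem Separable.isSepKernel {R : ℝ → ℝ → Matrix p q ℝ} (h : Separable a b R) :
    IsSepKernel a b ⊤ R := by
  obtain ⟨n, F, H, hF, hH, e⟩ := h
  exact ⟨Fin n, inferInstance, fun s => (F s)ᵀ, H, fun i j => hF j i, hH, e⟩

theorem IsSepKernel.separable {R : ℝ → ℝ → Matrix p q ℝ} (h : IsSepKernel a b ⊤ R) :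
    Separable a b R := by
  obtain ⟨ι, _, F, H, hF, hH, e⟩ := h
  let eq := Fintype.equivFin ι
  refine ⟨Fintype.card ι, fun s => ((F s).submatrix id eq.symm)ᵀ,
    fun θ => (H θ).submatrix eq.symm id, fun i j => hF j _, fun i j => hH _ j, ?_⟩
  intro s hs θ hθ
  rw [e s hs θ hθ, Matrix.transpose_transpose, Matrix.submatrix_mul_equiv, Matrix.submatrix_id_id]

theorem IsSepKernel.mul [Fintype r] {t : ℝ≥0∞} {F : ℝ → Matrix p r ℝ} {H : ℝ → Matrix r q ℝ}
    (hF : MatMemLp a b ⊤ F) (hH : MatMemLp a b t H) : IsSepKernel a b t fun s θ => F s * H θ :=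
  ⟨r, inferInstance, F, H, hF, hH, fun _ _ _ _ => rfl⟩

theorem IsSepKernel.congr {t : ℝ≥0∞} {R R' : ℝ → ℝ → Matrix p q ℝ} (h : IsSepKernel a b t R)
    (e : ∀ s ∈ Icc a b, ∀ θ ∈ Icc a b, R' s θ = R s θ) : IsSepKernel a b t R' := by
  obtain ⟨ι, _, F, H, hF, hH, e'⟩ := h
  exact ⟨ι, inferInstance, F, H, hF, hH, fun s hs θ hθ => (e s hs θ hθ).trans (e' s hs θ hθ)⟩

theorem IsSepKernel.add {t : ℝ≥0∞} {R R' : ℝ → ℝ → Matrix p q ℝ} (h : IsSepKernel a b t R)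
    (h' : IsSepKernel a b t R') : IsSepKernel a b t fun s θ => R s θ + R' s θ := by
  obtain ⟨ι, _, F, H, hF, hH, e⟩ := h
  obtain ⟨ι', _, F', H', hF', hH', e'⟩ := h'
  refine ⟨ι ⊕ ι', inferInstance, fun s => Matrix.fromCols (F s) (F' s),
    fun θ => Matrix.fromRows (H θ) (H' θ), ?_, ?_, fun s hs θ hθ => ?_⟩
  · rintro i (j | j)
    exacts [hF i j, hF' i j]
  · rintro (i | i) j
    exacts [hH i j, hH' i j]
  · beta_reduce
    rw [Matrix.fromCols_mul_fromRows, e s hs θ hθ, e' s hs θ hθ]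

theorem IsSepKernel.mul_left [Fintype p] {t : ℝ≥0∞} {M : ℝ → Matrix r p ℝ}
    {R : ℝ → ℝ → Matrix p q ℝ} (hM : MatMemLp a b ⊤ M) (h : IsSepKernel a b t R) :
    IsSepKernel a b t fun s θ => M s * R s θ := by
  obtain ⟨ι, _, F, H, hF, hH, e⟩ := h
  refine ⟨ι, inferInstance, fun s => M s * F s, H, hM.mul hF, hH, fun s hs θ hθ => ?_⟩
  beta_reduce
  rw [e s hs θ hθ, Matrix.mul_assoc]

theorem IsSepKernel.mul_right [Fintype q] {t : ℝ≥0∞} {M : ℝ → Matrix q r ℝ}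
    {R : ℝ → ℝ → Matrix p q ℝ} (h : IsSepKernel a b t R) (hM : MatMemLp a b ⊤ M) :
    IsSepKernel a b t fun s θ => R s θ * M θ := by
  obtain ⟨ι, _, F, H, hF, hH, e⟩ := h
  refine ⟨ι, inferInstance, F, fun θ => H θ * M θ, hF, hH.mul hM, fun s hs θ hθ => ?_⟩
  beta_reduce
  rw [e s hs θ hθ, Matrix.mul_assoc]

theorem matInt_mul_mul {ι κ : Type} [Fintype ι] [Fintype κ] (M : Matrix p ι ℝ)
    {X : ℝ → Matrix ι κ ℝ} (N : Matrix κ q ℝ) {c d : ℝ}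
    (hX : ∀ i j, IntervalIntegrable (fun s => X s i j) volume c d) :
    matInt c d (fun s => M * X s * N) = M * matInt c d X * N := by
  ext i j
  simp only [matInt, Matrix.of_apply, Matrix.mul_apply, Finset.sum_mul]
  have h (l : κ) (k : ι) : IntervalIntegrable (fun s => M i k * X s k l * N l j) volume c d :=
    ((hX k l).const_mul _).mul_const _
  rw [intervalIntegral.integral_finsetSum fun l _ =>
    intervalIntegrable_finsetSum _ fun k _ => h l k]
  refine Finset.sum_congr rfl fun l _ => ?_
  rw [intervalIntegral.integral_finsetSum fun k _ => h l k]
  simp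

theorem matInt_congr {X Y : ℝ → Matrix p q ℝ} {c d : ℝ} (h : ∀ s ∈ uIcc c d, X s = Y s) :
    matInt c d X = matInt c d Y := by
  ext i j
  exact intervalIntegral.integral_congr fun s hs => by simp [h s hs]

/-- A limit of integration that is constant or one of the variables `s`, `θ`. -/
def IsLimit (a b : ℝ) (e : ℝ → ℝ → ℝ) : Prop :=
  (∃ c ∈ Icc a b, e = fun _ _ => c) ∨ (e = fun s _ => s) ∨ e = fun _ θ => θ

theorem isLimit_const {c : ℝ} (hc : c ∈ Icc a b) : IsLimit a b fun _ _ => c := .inl ⟨c, hc, rfl⟩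

theorem isLimit_left : IsLimit a b fun s _ => s := .inr (.inl rfl)

theorem isLimit_right : IsLimit a b fun _ θ => θ := .inr (.inr rfl)

theorem IsLimit.mem {e : ℝ → ℝ → ℝ} (h : IsLimit a b e) {s θ : ℝ} (hs : s ∈ Icc a b)
    (hθ : θ ∈ Icc a b) : e s θ ∈ Icc a b := by
  obtain ⟨c, hc, rfl⟩ | rfl | rfl := h
  exacts [hc, hs, hθ]

theorem IsLimit.isSepKernel {ι κ : Type} [Fintype ι] [Fintype κ] {e : ℝ → ℝ → ℝ}
    (h : IsLimit a b e) {F : ℝ → Matrix p ι ℝ} {Φ : ℝ → Matrix ι κ ℝ} {H : ℝ → Matrix κ q ℝ}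
    (hF : MatMemLp a b ⊤ F) (hΦ : MatMemLp a b ⊤ Φ) (hH : MatMemLp a b ⊤ H) :
    IsSepKernel a b ⊤ fun s θ => F s * Φ (e s θ) * H θ := by
  obtain ⟨c, hc, rfl⟩ | rfl | rfl := h
  · exact IsSepKernel.mul (hF.mul (.const (Φ c) ⊤)) hH
  · exact IsSepKernel.mul (hF.mul hΦ) hH
  · simp only [Matrix.mul_assoc]
    exact IsSepKernel.mul hF (hΦ.mul hH)

/-- The composition of separable kernels over an interval whose limits are constants or variables
is separable. -/
theorem IsSepKernel.matInt [Fintype q] (hab : a < b) {R : ℝ → ℝ → Matrix p q ℝ}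
    {S : ℝ → ℝ → Matrix q r ℝ}
    (hR : IsSepKernel a b ⊤ R) (hS : IsSepKernel a b ⊤ S) {e e' : ℝ → ℝ → ℝ}
    (he : IsLimit a b e) (he' : IsLimit a b e') :
    IsSepKernel a b ⊤ fun s θ => matInt (e s θ) (e' s θ) fun β => R s β * S β θ := by
  obtain ⟨ι, _, F, H, hF, hH, eR⟩ := hR
  obtain ⟨κ, _, F', H', hF', hH', eS⟩ := hS
  have ha : a ∈ Icc a b := ⟨le_rfl, hab.le⟩
  have hX : MatMemLp a b ⊤ fun β => H β * F' β := hH.mul hF'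
  have hXi (i : ι) (j : κ) : Integrable (fun β => (H β * F' β) i j) (mu a b) :=
    (hX i j).integrable le_top
  set Φ : ℝ → Matrix ι κ ℝ := fun x => PIE.matInt a x fun β => H β * F' β with hΦdef
  have hΦ : MatMemLp a b ⊤ Φ := fun i j =>
    memLp_of_continuousOn (continuousOn_primitive hab.le (hXi i j)) ⊤
  have hneg : MatMemLp a b ⊤ fun x => -Φ x := fun i j => (hΦ i j).neg
  refine ((he'.isSepKernel hF hΦ hH').add (he.isSepKernel hF hneg hH')).congr
    fun s hs θ hθ => ?_
  have m1 := he.mem hs hθ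
  have m2 := he'.mem hs hθ
  have e1 : PIE.matInt (e s θ) (e' s θ) (fun β => R s β * S β θ) =
      PIE.matInt (e s θ) (e' s θ) fun β => F s * (H β * F' β) * H' θ := by
    refine matInt_congr fun β hβ => ?_
    have hβ' := uIcc_subset_Icc m1 m2 hβ
    rw [eR s hs β hβ', eS β hβ' θ hθ]
    simp only [Matrix.mul_assoc]
  have e2 : PIE.matInt (e s θ) (e' s θ) (fun β => H β * F' β) = Φ (e' s θ) - Φ (e s θ) := by
    ext i j
    have := intervalIntegral.integral_add_adjacent_intervals
      (intervalIntegrable_of_integrable (hXi i j) ha m1)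
      (intervalIntegrable_of_integrable (hXi i j) m1 m2)
    simp only [hΦdef, PIE.matInt, Matrix.of_apply, Matrix.sub_apply]
    linarith
  rw [e1, matInt_mul_mul _ _ fun i j => intervalIntegrable_of_integrable (hXi i j) m1 m2, e2,
    Matrix.mul_sub, Matrix.sub_mul, Matrix.mul_neg, Matrix.neg_mul, sub_eq_add_neg]

theorem ae_prod_mem_Icc : ∀ᵐ z ∂((mu a b).prod (mu a b)), z.1 ∈ Icc a b ∧ z.2 ∈ Icc a b := by
  rw [Measure.prod_restrict]
  exact ae_restrict_mem (measurableSet_Icc.prod measurableSet_Icc)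

theorem IsSepKernel.kernelL2 {R : ℝ → ℝ → Matrix p q ℝ} (h : IsSepKernel a b 2 R) :
    KernelL2 a b R := by
  obtain ⟨ι, _, F, H, hF, hH, e⟩ := h
  intro i j
  have hk (k : ι) : MemLp (fun z : ℝ × ℝ => F z.1 i k * H z.2 k j) 2 ((mu a b).prod (mu a b)) := by
    have hF2 : MemLp (fun s => F s i k) 2 (mu a b) := (hF i k).mono_exponent le_top
    have i1 := (memLp_two_iff_integrable_sq hF2.1).1 hF2
    have i2 := (memLp_two_iff_integrable_sq (hH k j).1).1 (hH k j)
    refine (memLp_two_iff_integrable_sq (hF2.1.comp_fst.mul (hH k j).1.comp_snd)).2 ?_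
    exact (i1.mul_prod i2).congr (.of_forall fun z => by simp [mul_pow])
  refine (memLp_finsetSum Finset.univ fun k _ => hk k).ae_eq ?_
  filter_upwards [ae_prod_mem_Icc] with z hz
  rw [e z.1 hz.1 z.2 hz.2, Matrix.mul_apply]

/-- The slices in `s` are essentially bounded for every `θ`, even if `R` is not bounded in `θ`. -/
theorem IsSepKernel.memLp_left {R : ℝ → ℝ → Matrix p q ℝ} {t : ℝ≥0∞} (h : IsSepKernel a b t R)
    {θ : ℝ} (hθ : θ ∈ Icc a b) (i : p) (j : q) : MemLp (fun β => R β θ i j) ⊤ (mu a b) := by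
  obtain ⟨ι, _, F, H, hF, hH, e⟩ := h
  refine (memLp_finsetSum Finset.univ fun k _ => (hF i k).mul_const (H θ k j)).ae_eq ?_
  filter_upwards [ae_mem_Icc] with s hs
  rw [e s hs θ hθ, Matrix.mul_apply]

theorem IsSepKernel.integrable_prod {R : ℝ → ℝ → Matrix p q ℝ} (h : IsSepKernel a b 2 R)
    {f g : ℝ → ℝ} (hf : MemLp f 2 (mu a b)) (hg : MemLp g 2 (mu a b)) (i : p) (j : q) :
    Integrable (fun z : ℝ × ℝ => f z.1 * R z.1 z.2 i j * g z.2) ((mu a b).prod (mu a b)) := by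
  obtain ⟨ι, _, F, H, hF, hH, e⟩ := h
  have hk (k : ι) : Integrable (fun z : ℝ × ℝ => (f z.1 * F z.1 i k) * (H z.2 k j * g z.2))
      ((mu a b).prod (mu a b)) :=
    Integrable.mul_prod (f := fun s => f s * F s i k) (g := fun θ => H θ k j * g θ)
      (integrable_of_memLp_two ((hF i k).mul hf)) ((hH k j).integrable_mul hg)
  refine (integrable_finsetSum Finset.univ fun k _ => hk k).congr ?_
  filter_upwards [ae_prod_mem_Icc] with z hz
  rw [e z.1 hz.1 z.2 hz.2, Matrix.mul_apply, Finset.mul_sum, Finset.sum_mul]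
  exact Finset.sum_congr rfl fun k _ => by ring

end SeparableKernels

section SeparableParameters

variable {a b : ℝ} {n₀ n₁ n₂ m : ℕ}

/-- As `Q` is affine, `Q(s-θ)` is the sum of a function of `s` and a function of `θ`. -/
theorem isSepKernel_Qmat {p : Type} (K : Matrix p (IC n₁ n₂) ℝ) (t : ℝ≥0∞) :
    IsSepKernel a b t fun s θ => K * Qmat n₀ n₁ n₂ (s - θ) := by
  have h1 : MatMemLp a b ⊤ fun s => K * Qmat n₀ n₁ n₂ s :=
    (MatMemLp.const _ _).mul (.of_continuous (fun k j => continuous_Qmat k j) _)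
  have h2 : MatMemLp a b t fun θ => Qmat n₀ n₁ n₂ (0 - θ) - Qmat n₀ n₁ n₂ 0 :=
    (MatMemLp.of_continuous (fun k j => (continuous_Qmat k j).comp
      (continuous_const.sub continuous_id)) t).sub (.const _ _)
  refine ((IsSepKernel.mul h1 (.const 1 t)).add (IsSepKernel.mul (.const K ⊤) h2)).congr
    fun s _ θ _ => ?_
  rw [Matrix.mul_one, ← Matrix.mul_add]
  congr 1
  ext k j
  simp only [Matrix.add_apply, Matrix.sub_apply]
  rw [Qmat_apply (s - θ), Qmat_apply s, Qmat_apply (0 - θ)]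
  ring

theorem isSepKernel_Tmat_BQ (hab : a < b) (G : BoundaryParams n₀ n₁ n₂ m) {t : ℝ≥0∞} (ht : 2 ≤ t)
    (hBI : MatMemLp a b t G.BI) {p : Type} (K : Matrix p (IC n₁ n₂) ℝ) :
    IsSepKernel a b t fun s θ => K * Tmat n₁ n₂ (s - a) * BQ a b G θ :=
  IsSepKernel.mul ((MatMemLp.const K ⊤).mul (matMemLp_Tmat a ⊤)) (matMemLp_BQ hab G ht hBI)

theorem G2_eq (G : BoundaryParams n₀ n₁ n₂ m) : G2 a b G =
    fun s θ => embC n₀ n₁ n₂ * Tmat n₁ n₂ (s - a) * BQ a b G θ := by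
  ext1 s; ext1 θ
  rw [embC_mul_Tmat, Matrix.fromRows_mul, Matrix.zero_mul, G2]

theorem G1_eq (G : BoundaryParams n₀ n₁ n₂ m) : G1 a b G =
    fun s θ => embC n₀ n₁ n₂ * Tmat n₁ n₂ (s - a) * BQ a b G θ +
      embC n₀ n₁ n₂ * Qmat n₀ n₁ n₂ (s - θ) := by
  ext1 s; ext1 θ
  rw [embC_mul_Qmat, G1, G2_eq, add_comm]

theorem isSepKernel_G2 (hab : a < b) (G : BoundaryParams n₀ n₁ n₂ m) {t : ℝ≥0∞} (ht : 2 ≤ t)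
    (hBI : MatMemLp a b t G.BI) : IsSepKernel a b t (G2 a b G) := by
  rw [G2_eq]
  exact isSepKernel_Tmat_BQ hab G ht hBI _

theorem isSepKernel_G1 (hab : a < b) (G : BoundaryParams n₀ n₁ n₂ m) {t : ℝ≥0∞} (ht : 2 ≤ t)
    (hBI : MatMemLp a b t G.BI) : IsSepKernel a b t (G1 a b G) := by
  rw [G1_eq]
  exact (isSepKernel_Tmat_BQ hab G ht hBI _).add (isSepKernel_Qmat _ t)

theorem isSepKernel_RD2 (hab : a < b) (G : BoundaryParams n₀ n₁ n₂ m) {t : ℝ≥0∞} (ht : 2 ≤ t)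
    (hBI : MatMemLp a b t G.BI) : IsSepKernel a b t (RD2 a b G) :=
  isSepKernel_Tmat_BQ hab G ht hBI _

theorem isSepKernel_RD1 (hab : a < b) (G : BoundaryParams n₀ n₁ n₂ m) {t : ℝ≥0∞} (ht : 2 ≤ t)
    (hBI : MatMemLp a b t G.BI) : IsSepKernel a b t (RD1 a b G) :=
  (isSepKernel_RD2 hab G ht hBI).add (isSepKernel_Qmat _ t)

theorem isSepKernel_Ahat1 (hab : a < b) (G : BoundaryParams n₀ n₁ n₂ m)
    (P : DynamicsParams n₀ n₁ n₂) (hBI : MatMemLp a b ⊤ G.BI) (hA0 : MatMemLp a b ⊤ P.A0)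
    (h1 : IsSepKernel a b ⊤ P.A1) (h2 : IsSepKernel a b ⊤ P.A2) :
    IsSepKernel a b ⊤ (Ahat1 a b G P) := by
  have r1 := isSepKernel_RD1 hab G le_top hBI
  have r2 := isSepKernel_RD2 hab G le_top hBI
  have ha := isLimit_const (a := a) (b := b) (c := a) ⟨le_rfl, hab.le⟩
  have hb := isLimit_const (a := a) (b := b) (c := b) ⟨hab.le, le_rfl⟩
  exact ((((IsSepKernel.mul_left hA0 r1).add (h1.mul_right (.const _ _))).add
    (h1.matInt hab r2 ha isLimit_right)).add (h1.matInt hab r1 isLimit_right isLimit_left)).add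
    (h2.matInt hab r1 isLimit_left hb)

theorem isSepKernel_Ahat2 (hab : a < b) (G : BoundaryParams n₀ n₁ n₂ m)
    (P : DynamicsParams n₀ n₁ n₂) (hBI : MatMemLp a b ⊤ G.BI) (hA0 : MatMemLp a b ⊤ P.A0)
    (h1 : IsSepKernel a b ⊤ P.A1) (h2 : IsSepKernel a b ⊤ P.A2) :
    IsSepKernel a b ⊤ (Ahat2 a b G P) := by
  have r1 := isSepKernel_RD1 hab G le_top hBI
  have r2 := isSepKernel_RD2 hab G le_top hBI
  have ha := isLimit_const (a := a) (b := b) (c := a) ⟨le_rfl, hab.le⟩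
  have hb := isLimit_const (a := a) (b := b) (c := b) ⟨hab.le, le_rfl⟩
  exact ((((IsSepKernel.mul_left hA0 r2).add (h2.mul_right (.const _ _))).add
    (h1.matInt hab r2 ha isLimit_left)).add (h2.matInt hab r2 isLimit_left isLimit_right)).add
    (h2.matInt hab r1 isLimit_right hb)

end SeparableParameters

/-! ### Composition of 3-PI operators -/

section Composition

variable {p q r : Type} {a b : ℝ}

theorem IsSepKernel.memLp_triKernel_left {R1 R2 : ℝ → ℝ → Matrix p q ℝ} {t : ℝ≥0∞}
    (h1 : IsSepKernel a b t R1) (h2 : IsSepKernel a b t R2) {θ : ℝ} (hθ : θ ∈ Icc a b) (i : p)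
    (j : q) : MemLp (fun β => triKernel R1 R2 β θ i j) ⊤ (mu a b) := by
  refine (((h1.memLp_left hθ i j).indicator (measurableSet_Ici (a := θ))).add
    ((h2.memLp_left hθ i j).indicator (measurableSet_Ici (a := θ)).compl)).ae_eq
    (.of_forall fun β => ?_)
  by_cases h : θ ≤ β <;> simp [triKernel, h, indicator]

theorem integrable_prod_triKernel {R1 R2 : ℝ → ℝ → Matrix p q ℝ}
    (h1 : IsSepKernel a b 2 R1) (h2 : IsSepKernel a b 2 R2) {f g : ℝ → ℝ}
    (hf : MemLp f 2 (mu a b)) (hg : MemLp g 2 (mu a b)) (i : p) (j : q) :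
    Integrable (fun z : ℝ × ℝ => f z.1 * triKernel R1 R2 z.1 z.2 i j * g z.2)
      ((mu a b).prod (mu a b)) := by
  have hS : MeasurableSet {z : ℝ × ℝ | z.2 ≤ z.1} := measurableSet_le measurable_snd measurable_fst
  refine (((h1.integrable_prod hf hg i j).indicator hS).add
    ((h2.integrable_prod hf hg i j).indicator hS.compl)).congr (.of_forall ?_)
  rintro ⟨s, θ⟩
  by_cases h : θ ≤ s <;> simp [triKernel, h, indicator]

variable [Fintype q]

/-- The product of two triangular kernels, cut at `s` and `θ`, for `θ ≤ s`. -/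
theorem integral_triKernel_mul_of_le {A1 A2 : ℝ → ℝ → Matrix p q ℝ} {R1 R2 : ℝ → ℝ → Matrix q r ℝ}
    {s θ : ℝ} (hs : s ∈ Icc a b) (hθ : θ ∈ Icc a b) (hle : θ ≤ s) {i : p} {j : r}
    (hint : ∀ k, Integrable (fun β => triKernel A1 A2 s β i k * triKernel R1 R2 β θ k j)
      (mu a b)) :
    ∑ k, ∫ β, triKernel A1 A2 s β i k * triKernel R1 R2 β θ k j ∂(mu a b) =
      matInt a θ (fun β => A1 s β * R2 β θ) i j + matInt θ s (fun β => A1 s β * R1 β θ) i j +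
        matInt s b (fun β => A2 s β * R1 β θ) i j := by
  have hab := hs.1.trans hs.2
  have ha : a ∈ Icc a b := ⟨le_rfl, hab⟩
  have hb : b ∈ Icc a b := ⟨hab, le_rfl⟩
  have hsum := integrable_finsetSum Finset.univ fun k _ => hint k
  rw [← integral_finsetSum _ fun k _ => hint k, ← intervalIntegral_eq_integral_mu hab,
    ← intervalIntegral.integral_add_adjacent_intervals
      (intervalIntegrable_of_integrable hsum ha hs) (intervalIntegrable_of_integrable hsum hs hb),
    ← intervalIntegral.integral_add_adjacent_intervals
      (intervalIntegrable_of_integrable hsum ha hθ) (intervalIntegrable_of_integrable hsum hθ hs)]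
  simp only [matInt, Matrix.of_apply, Matrix.mul_apply]
  refine congrArg₂ (· + ·) (congrArg₂ (· + ·) ?_ ?_) ?_
  · refine intervalIntegral.integral_congr_uIoo fun β hβ => ?_
    rw [uIoo_of_le hθ.1] at hβ
    simp [triKernel, (hβ.2.trans_le hle).le, not_le.2 hβ.2]
  · refine intervalIntegral.integral_congr_uIoo fun β hβ => ?_
    rw [uIoo_of_le hle] at hβ
    simp [triKernel, hβ.2.le, hβ.1.le]
  · refine intervalIntegral.integral_congr_uIoo fun β hβ => ?_
    rw [uIoo_of_le hs.2] at hβ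
    simp [triKernel, not_le.2 hβ.1, hle.trans hβ.1.le]

/-- The product of two triangular kernels, cut at `s` and `θ`, for `s < θ`. -/
theorem integral_triKernel_mul_of_lt {A1 A2 : ℝ → ℝ → Matrix p q ℝ} {R1 R2 : ℝ → ℝ → Matrix q r ℝ}
    {s θ : ℝ} (hs : s ∈ Icc a b) (hθ : θ ∈ Icc a b) (hlt : s < θ) {i : p} {j : r}
    (hint : ∀ k, Integrable (fun β => triKernel A1 A2 s β i k * triKernel R1 R2 β θ k j)
      (mu a b)) :
    ∑ k, ∫ β, triKernel A1 A2 s β i k * triKernel R1 R2 β θ k j ∂(mu a b) =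
      matInt a s (fun β => A1 s β * R2 β θ) i j + matInt s θ (fun β => A2 s β * R2 β θ) i j +
        matInt θ b (fun β => A2 s β * R1 β θ) i j := by
  have hab := hs.1.trans hs.2
  have ha : a ∈ Icc a b := ⟨le_rfl, hab⟩
  have hb : b ∈ Icc a b := ⟨hab, le_rfl⟩
  have hsum := integrable_finsetSum Finset.univ fun k _ => hint k
  rw [← integral_finsetSum _ fun k _ => hint k, ← intervalIntegral_eq_integral_mu hab,
    ← intervalIntegral.integral_add_adjacent_intervals
      (intervalIntegrable_of_integrable hsum ha hθ) (intervalIntegrable_of_integrable hsum hθ hb),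
    ← intervalIntegral.integral_add_adjacent_intervals
      (intervalIntegrable_of_integrable hsum ha hs) (intervalIntegrable_of_integrable hsum hs hθ)]
  simp only [matInt, Matrix.of_apply, Matrix.mul_apply]
  refine congrArg₂ (· + ·) (congrArg₂ (· + ·) ?_ ?_) ?_
  · refine intervalIntegral.integral_congr_uIoo fun β hβ => ?_
    rw [uIoo_of_le hs.1] at hβ
    simp [triKernel, hβ.2.le, not_le.2 (hβ.2.trans hlt)]
  · refine intervalIntegral.integral_congr_uIoo fun β hβ => ?_
    rw [uIoo_of_le hlt.le] at hβ
    simp [triKernel, not_le.2 hβ.1, not_le.2 hβ.2]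
  · refine intervalIntegral.integral_congr_uIoo fun β hβ => ?_
    rw [uIoo_of_le hθ.2] at hβ
    simp [triKernel, not_le.2 (hlt.trans hβ.1), hβ.1.le]

/-- The kernel on `θ ≤ s` of the composition of two 3-PI operators. -/
noncomputable def compKernel1 (a b : ℝ) (A0 : ℝ → Matrix p q ℝ) (A1 A2 : ℝ → ℝ → Matrix p q ℝ)
    (U : Matrix q r ℝ) (R1 R2 : ℝ → ℝ → Matrix q r ℝ) (s θ : ℝ) : Matrix p r ℝ :=
  A0 s * R1 s θ + A1 s θ * U + matInt a θ (fun β => A1 s β * R2 β θ) +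
    matInt θ s (fun β => A1 s β * R1 β θ) + matInt s b (fun β => A2 s β * R1 β θ)

/-- The kernel on `s < θ` of the composition of two 3-PI operators. -/
noncomputable def compKernel2 (a b : ℝ) (A0 : ℝ → Matrix p q ℝ) (A1 A2 : ℝ → ℝ → Matrix p q ℝ)
    (U : Matrix q r ℝ) (R1 R2 : ℝ → ℝ → Matrix q r ℝ) (s θ : ℝ) : Matrix p r ℝ :=
  A0 s * R2 s θ + A2 s θ * U + matInt a s (fun β => A1 s β * R2 β θ) +
    matInt s θ (fun β => A2 s β * R2 β θ) + matInt θ b (fun β => A2 s β * R1 β θ)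

theorem triKernel_compKernel {A0 : ℝ → Matrix p q ℝ} {A1 A2 : ℝ → ℝ → Matrix p q ℝ}
    {U : Matrix q r ℝ} {R1 R2 : ℝ → ℝ → Matrix q r ℝ} {s θ : ℝ} (hs : s ∈ Icc a b)
    (hθ : θ ∈ Icc a b) {i : p} {j : r}
    (hint : ∀ k, Integrable (fun β => triKernel A1 A2 s β i k * triKernel R1 R2 β θ k j)
      (mu a b)) :
    triKernel (compKernel1 a b A0 A1 A2 U R1 R2) (compKernel2 a b A0 A1 A2 U R1 R2) s θ i j =
      ∑ k, (A0 s i k * triKernel R1 R2 s θ k j + triKernel A1 A2 s θ i k * U k j +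
        ∫ β, triKernel A1 A2 s β i k * triKernel R1 R2 β θ k j ∂(mu a b)) := by
  rw [Finset.sum_add_distrib, Finset.sum_add_distrib]
  rcases le_or_gt θ s with h | h
  · rw [integral_triKernel_mul_of_le hs hθ h hint]
    simp only [triKernel, h, if_true, compKernel1, Matrix.add_apply, Matrix.mul_apply]
    ring
  · rw [integral_triKernel_mul_of_lt hs hθ h hint]
    simp only [triKernel, not_le.2 h, if_false, compKernel2, Matrix.add_apply, Matrix.mul_apply]
    ring

variable [Fintype p] [Fintype r]

/-- The composition of a 3-PI operator with square-integrable kernels and a 3-PI operator with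
separable kernels is a 3-PI operator, by Fubini's theorem. -/
theorem IsPI.comp {A : L2 a b q →L[ℝ] L2 a b p} {R : L2 a b r →L[ℝ] L2 a b q}
    {A0 : ℝ → Matrix p q ℝ} {A1 A2 : ℝ → ℝ → Matrix p q ℝ} {U : Matrix q r ℝ}
    {R1 R2 : ℝ → ℝ → Matrix q r ℝ} (hA : IsPI A A0 A1 A2) (hR : IsPI R (fun _ => U) R1 R2)
    (hA1 : KernelL2 a b A1) (hA2 : KernelL2 a b A2) (hR1 : IsSepKernel a b 2 R1)
    (hR2 : IsSepKernel a b 2 R2) :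
    IsPI (A ∘L R) (fun s => A0 s * U) (compKernel1 a b A0 A1 A2 U R1 R2)
      (compKernel2 a b A0 A1 A2 U R1 R2) := by
  intro v
  have hv := memLp_coord v
  have hw := memLp_coord (R v)
  have hRv : ∀ᵐ s ∂(mu a b), ∀ k, R v s k =
      ∑ j, (U k j * v s j + ∫ θ, triKernel R1 R2 s θ k j * v θ j ∂(mu a b)) := by
    filter_upwards [hR v, piFun_apply_ae (R0 := fun _ => U) hR1.kernelL2 hR2.kernelL2 hv]
      with s e1 e2 k
    rw [e1, e2]
  filter_upwards [hA (R v), piFun_apply_ae (R0 := A0) hA1 hA2 hw, hRv,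
    (hA1.triKernel hA2).slice_ae, (hR1.kernelL2.triKernel hR2.kernelL2).slice_ae, ae_mem_Icc]
    with s e1 e2 e3 hAs hRs hs
  have hprod (i : p) (k : q) (j : r) := integrable_prod_triKernel hR1 hR2 (hAs i k) (hv j) k j
  have hint (i : p) (k : q) (j : r) : ∀ θ ∈ Icc a b,
      Integrable (fun β => triKernel A1 A2 s β i k * triKernel R1 R2 β θ k j) (mu a b) :=
    fun θ hθ => integrable_of_memLp_two ((hR1.memLp_triKernel_left hR2 hθ k j).mul (hAs i k))
  have hcomp (i : p) (j : r) : (fun θ => ∑ k, (A0 s i k * (triKernel R1 R2 s θ k j * v θ j) +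
      triKernel A1 A2 s θ i k * v θ j * U k j +
        ∫ β, triKernel A1 A2 s β i k * triKernel R1 R2 β θ k j * v θ j ∂(mu a b))) =ᵐ[mu a b]
      fun θ => triKernel (compKernel1 a b A0 A1 A2 U R1 R2) (compKernel2 a b A0 A1 A2 U R1 R2)
        s θ i j * v θ j := by
    filter_upwards [ae_mem_Icc] with θ hθ
    rw [triKernel_compKernel hs hθ fun k => hint i k j θ hθ, Finset.sum_mul]
    refine Finset.sum_congr rfl fun k _ => ?_
    rw [integral_mul_const]
    ring
  have i1 (k : q) (j : r) : Integrable (fun θ => triKernel R1 R2 s θ k j * v θ j) (mu a b) :=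
    (hRs k j).integrable_mul (hv j)
  have i2 (i : p) (k : q) (j : r) :
      Integrable (fun θ => triKernel A1 A2 s θ i k * v θ j) (mu a b) :=
    (hAs i k).integrable_mul (hv j)
  have i3 (i : p) (k : q) (j : r) : Integrable (fun θ => ∫ β, triKernel A1 A2 s β i k *
      triKernel R1 R2 β θ k j * v θ j ∂(mu a b)) (mu a b) := (hprod i k j).integral_prod_right
  have i4 (i : p) (k : q) (j : r) : Integrable (fun β => ∫ θ, triKernel A1 A2 s β i k *
      triKernel R1 R2 β θ k j * v θ j ∂(mu a b)) (mu a b) := (hprod i k j).integral_prod_left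
  have i12 (i : p) (j : r) (k : q) := ((i1 k j).const_mul (A0 s i k)).add
    ((i2 i k j).mul_const (U k j))
  have hI (i : p) (j : r) := (integrable_finsetSum Finset.univ fun k _ =>
    (i12 i j k).add (i3 i k j)).congr (hcomp i j)
  ext i
  rw [ContinuousLinearMap.comp_apply, e1, e2, piFun_apply hs hI]
  have hA' (k : q) : ∫ β, triKernel A1 A2 s β i k * R v β k ∂(mu a b) =
      ∑ j, ((∫ β, triKernel A1 A2 s β i k * v β j ∂(mu a b)) * U k j +
        ∫ θ, (∫ β, triKernel A1 A2 s β i k * triKernel R1 R2 β θ k j * v θ j ∂(mu a b))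
          ∂(mu a b)) := by
    have : (fun β => triKernel A1 A2 s β i k * R v β k) =ᵐ[mu a b] fun β =>
        ∑ j, (triKernel A1 A2 s β i k * v β j * U k j + ∫ θ, triKernel A1 A2 s β i k *
          triKernel R1 R2 β θ k j * v θ j ∂(mu a b)) := by
      filter_upwards [hRv] with β hβ
      rw [hβ, Finset.mul_sum]
      refine Finset.sum_congr rfl fun j _ => ?_
      simp only [mul_assoc, integral_const_mul]
      ring
    rw [integral_congr_ae this]
    refine (integral_finsetSum _ fun j _ =>
      ((i2 i k j).mul_const (U k j)).add (i4 i k j)).trans ?_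
    refine Finset.sum_congr rfl fun j _ => ?_
    refine (integral_add ((i2 i k j).mul_const (U k j)) (i4 i k j)).trans ?_
    rw [integral_mul_const, integral_integral_swap (hprod i k j)]
  have hC (j : r) : ∫ θ, triKernel (compKernel1 a b A0 A1 A2 U R1 R2)
      (compKernel2 a b A0 A1 A2 U R1 R2) s θ i j * v θ j ∂(mu a b) =
      ∑ k, (A0 s i k * (∫ θ, triKernel R1 R2 s θ k j * v θ j ∂(mu a b)) +
        (∫ θ, triKernel A1 A2 s θ i k * v θ j ∂(mu a b)) * U k j +
        ∫ θ, (∫ β, triKernel A1 A2 s β i k * triKernel R1 R2 β θ k j * v θ j ∂(mu a b))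
          ∂(mu a b)) := by
    rw [← integral_congr_ae (hcomp i j)]
    refine (integral_finsetSum _ fun k _ => (i12 i j k).add (i3 i k j)).trans ?_
    refine Finset.sum_congr rfl fun k _ => ?_
    rw [← integral_mul_const, ← integral_const_mul, ← integral_add
      ((i1 k j).const_mul (A0 s i k)) ((i2 i k j).mul_const (U k j))]
    exact integral_add (i12 i j k) (i3 i k j)
  simp only [hA', hC, e3, Finset.mul_sum, Matrix.mul_apply, Finset.sum_mul,
    ← Finset.sum_add_distrib]
  rw [Finset.sum_comm]
  refine Finset.sum_congr rfl fun j _ => Finset.sum_congr rfl fun k _ => ?_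
  ring

end Composition

/-! ### The bijection between `X` and `L₂` -/

section StateMap

variable {a b : ℝ} {n₀ n₁ n₂ m : ℕ}

theorem piFun_congr {p q : Type} [Fintype p] [Fintype q] {R0 : ℝ → Matrix p q ℝ}
    {R1 R2 : ℝ → ℝ → Matrix p q ℝ} {v w : ℝ → q → ℝ} (h : v =ᵐ[mu a b] w) :
    piFun a b R0 R1 R2 v =ᵐ[mu a b] piFun a b R0 R1 R2 w := by
  filter_upwards [h, ae_mem_Icc] with s e hs
  have ha : a ∈ Icc a b := ⟨le_rfl, hs.1.trans hs.2⟩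
  have hb : b ∈ Icc a b := ⟨hs.1.trans hs.2, le_rfl⟩
  rw [piFun, piFun, e,
    intervalIntegral_congr_mu (g := fun θ => R1 s θ *ᵥ w θ) ha hs
      (by filter_upwards [h] with θ hθ; rw [hθ]),
    intervalIntegral_congr_mu (g := fun θ => R2 s θ *ᵥ w θ) hs hb
      (by filter_upwards [h] with θ hθ; rw [hθ])]

/-- A function in `Wⁿ` belongs to `X` if and only if the initial data in its Taylor formula are those
given by `B_Q`. -/
theorem memX_iff (hab : a < b) (G : BoundaryParams n₀ n₁ n₂ m) (hBI : MatMemLp a b 2 G.BI)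
    (hadm : Admissible a b G) (x : L2 a b (IX n₀ n₁ n₂)) :
    MemX G x ↔ MemW x ∧ xC x =ᵐ[mu a b]
      taylor a (bdry a b G fun s => (D x s).ofLp) fun s => (D x s).ofLp := by
  have ha : a ∈ Icc a b := ⟨le_rfl, hab.le⟩
  have hb : b ∈ Icc a b := ⟨hab.le, le_rfl⟩
  have hint (y : IC n₁ n₂ → ℝ) (hy : xC x =ᵐ[mu a b] taylor a y fun s => (D x s).ofLp) :
      ∫ s in a..b, G.BI s *ᵥ xD x s = ∫ s in a..b, G.BI s *ᵥ (U1 n₀ n₁ n₂ *ᵥ (D x s).ofLp +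
        U2 n₀ n₁ n₂ *ᵥ taylor a y (fun s => (D x s).ofLp) s) := by
    refine intervalIntegral_congr_mu ha hb ?_
    filter_upwards [hy, D_coeFn x] with s e1 e2
    rw [xD_eq, e1, e2]
  have hcont (y : IC n₁ n₂ → ℝ) : ContinuousOn (taylor a y fun s => (D x s).ofLp) (Icc a b) :=
    continuousOn_taylor hab (fun j => integrable_coord (D x) j) y
  have hbd := boundary_iff hab G hBI hadm (memLp_coord (D x))
  constructor
  · rintro ⟨hW, c, hc, hcx, hB⟩
    obtain ⟨y, hy⟩ := hW.exists_xC_ae_eq_taylor hab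
    -- Continuous functions that agree almost everywhere agree at the end points.
    have hcy := Measure.eqOn_Icc_of_ae_eq volume hab.ne (hcx.trans hy) hc (hcont y)
    rw [hcy ha, hcy hb, hint y hy, hbd y] at hB
    rw [hB] at hy
    exact ⟨hW, hy⟩
  · rintro ⟨hW, hy⟩
    refine ⟨hW, _, hcont _, hy.symm, ?_⟩
    rw [hint _ hy, hbd]
    rfl

variable {G : BoundaryParams n₀ n₁ n₂ m}
  {T : L2 a b (IX n₀ n₁ n₂) →L[ℝ] L2 a b (IX n₀ n₁ n₂)}

theorem ofLp_T_ae_eq (hab : a < b) (hBI : MatMemLp a b 2 G.BI)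
    (hT : IsPI T (G0 n₀ n₁ n₂) (G1 a b G) (G2 a b G)) (v : L2 a b (IX n₀ n₁ n₂)) :
    ∀ᵐ s ∂(mu a b), (T v s).ofLp = G0 n₀ n₁ n₂ s *ᵥ (v s).ofLp + embC n₀ n₁ n₂ *ᵥ
      taylor a (bdry a b G fun s => (v s).ofLp) (fun s => (v s).ofLp) s := by
  filter_upwards [hT v, ae_mem_Icc] with s e hs
  rw [e, G1_eq, G2_eq, piFun_eq_taylor hab G hBI (memLp_coord v) _ _ hs]

/-- The operator `T` maps `L₂` into `X` and is a right inverse of `𝒟`. -/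
theorem memX_T (hab : a < b) (hBI : MatMemLp a b 2 G.BI) (hadm : Admissible a b G)
    (hT : IsPI T (G0 n₀ n₁ n₂) (G1 a b G) (G2 a b G)) (v : L2 a b (IX n₀ n₁ n₂)) :
    MemX G (T v) ∧ D (T v) = v := by
  obtain ⟨h1, h2, h3⟩ := memW_of_ae_eq_taylor hab (ofLp_T_ae_eq hab hBI hT v)
  refine ⟨(memX_iff hab G hBI hadm _).2 ⟨h1, ?_⟩, h2⟩
  rwa [h2]

/-- On `X` the operator `T` is a left inverse of `𝒟`. -/
theorem T_D (hab : a < b) (hBI : MatMemLp a b 2 G.BI) (hadm : Admissible a b G)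
    (hT : IsPI T (G0 n₀ n₁ n₂) (G1 a b G) (G2 a b G)) {x : L2 a b (IX n₀ n₁ n₂)}
    (hx : MemX G x) : T (D x) = x := by
  refine Lp.ext ?_
  filter_upwards [ofLp_T_ae_eq hab hBI hT (D x), ((memX_iff hab G hBI hadm x).1 hx).2, D_coeFn x]
    with s e1 e2 e3
  ext1
  rw [e1, ofLp_eq x s, e2, e3]

/-- On `X` the operator with parameters `U₁`, `R_{D,1}`, `R_{D,2}` maps `𝒟x` to `x_D`. -/
theorem RD_D_ae_eq (hab : a < b) (hBI : MatMemLp a b 2 G.BI) (hadm : Admissible a b G)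
    {R : L2 a b (IX n₀ n₁ n₂) →L[ℝ] L2 a b (ID n₀ n₁ n₂)}
    (hR : IsPI R (fun _ => U1 n₀ n₁ n₂) (RD1 a b G) (RD2 a b G)) {x : L2 a b (IX n₀ n₁ n₂)}
    (hx : MemX G x) : (fun s => (R (D x) s).ofLp) =ᵐ[mu a b] xD x := by
  filter_upwards [hR (D x), ((memX_iff hab G hBI hadm x).1 hx).2, D_coeFn x, ae_mem_Icc]
    with s e1 e2 e3 hs
  have e4 := piFun_eq_taylor hab G hBI (memLp_coord (D x)) (fun _ => U1 n₀ n₁ n₂)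
    (U2 n₀ n₁ n₂) hs
  rw [e1, xD_eq, e2, ← e3]
  exact congrArg WithLp.ofLp e4

end StateMap

/-! ### Differentiation in the `T`-norm -/

section TNorm

open Filter Topology

/-- If the composition of `g` with a linear isometry of a complete space is differentiable, so is `g`,
because the range of the isometry is closed and contains the limit of the difference quotients. -/
theorem hasDerivAt_of_linearIsometry_comp {F H : Type*} [NormedAddCommGroup F] [NormedSpace ℝ F]
    [CompleteSpace F] [NormedAddCommGroup H] [NormedSpace ℝ H] (L : F →ₗᵢ[ℝ] H) {g : ℝ → F} {t : ℝ}
    {y : H} (h : HasDerivAt (fun τ => L (g τ)) y t) : ∃ w, L w = y ∧ HasDerivAt g w t := by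
  rw [hasDerivAt_iff_tendsto_slope] at h
  have hs : slope (fun τ => L (g τ)) t = fun τ => L (slope g t τ) := by
    ext τ
    simp [slope_def_module]
  rw [hs] at h
  have hcl : IsClosed (range L) := L.isometry.isClosedEmbedding.isClosed_range
  obtain ⟨w, hw⟩ := hcl.mem_of_tendsto h (.of_forall fun τ => mem_range_self _)
  refine ⟨w, hw, ?_⟩
  rw [hasDerivAt_iff_tendsto_slope, L.isometry.isEmbedding.tendsto_nhds_iff, hw]
  exact h

variable {E : Type*} [NormedAddCommGroup E] [NormedSpace ℝ E]

theorem TSpace.isometry_map (T : E →L[ℝ] E) : Isometry (TSpace.map T) :=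
  AddMonoidHomClass.isometry_of_norm _ fun _ => rfl

theorem TSpace.ext_coe (T : E →L[ℝ] E) (v : TSpace T) :
    TSpace.ext T (v : TCompletion T) = TSpace.map T v :=
  UniformSpace.Completion.extension_coe (TSpace.isometry_map T).uniformContinuous v

variable [CompleteSpace E]

theorem TSpace.continuous_ext (T : E →L[ℝ] E) : Continuous (TSpace.ext T) :=
  UniformSpace.Completion.continuous_extension

theorem TSpace.ext_add (T : E →L[ℝ] E) (x y : TCompletion T) :
    TSpace.ext T (x + y) = TSpace.ext T x + TSpace.ext T y := by
  have hc := TSpace.continuous_ext T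
  induction x, y using UniformSpace.Completion.induction_on₂ with
  | hp => exact isClosed_eq (by fun_prop) (by fun_prop)
  | ih x y => rw [← UniformSpace.Completion.coe_add]; simp only [TSpace.ext_coe, map_add]

theorem TSpace.ext_smul (T : E →L[ℝ] E) (c : ℝ) (x : TCompletion T) :
    TSpace.ext T (c • x) = c • TSpace.ext T x := by
  have hc := TSpace.continuous_ext T
  induction x using UniformSpace.Completion.induction_on with
  | hp => exact isClosed_eq (hc.comp (continuous_const_smul c)) (hc.const_smul c)
  | ih x =>
    rw [← UniformSpace.Completion.coe_smul, TSpace.ext_coe, TSpace.ext_coe]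
    exact (TSpace.map T).map_smul c x

theorem TSpace.norm_ext (T : E →L[ℝ] E) (x : TCompletion T) : ‖TSpace.ext T x‖ = ‖x‖ := by
  have hc := TSpace.continuous_ext T
  induction x using UniformSpace.Completion.induction_on with
  | hp => exact isClosed_eq hc.norm continuous_norm
  | ih x => rw [TSpace.ext_coe, UniformSpace.Completion.norm_coe]; rfl

/-- The extension of `T` to the completion in the `T`-norm is a linear isometry. -/
noncomputable def TSpace.extIsometry (T : E →L[ℝ] E) : TCompletion T →ₗᵢ[ℝ] E where
  toFun := TSpace.ext T
  map_add' := TSpace.ext_add T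
  map_smul' := TSpace.ext_smul T
  norm_map' := TSpace.norm_ext T

theorem TSpace.extIsometry_emb (T : E →L[ℝ] E) (v : E) :
    TSpace.extIsometry T (TSpace.emb T v) = T v := TSpace.ext_coe T v

/-- Differentiability of `f` in the `T`-norm is differentiability of `T f`, and the extension of `T`
maps one derivative to the other. -/
theorem TSpace.differentiableAt_emb_iff (T : E →L[ℝ] E) (f : ℝ → E) (t : ℝ) :
    (DifferentiableAt ℝ (fun τ => TSpace.emb T (f τ)) t ↔
      DifferentiableAt ℝ (fun τ => T (f τ)) t) ∧
    TSpace.ext T (deriv (fun τ => TSpace.emb T (f τ)) t) = deriv (fun τ => T (f τ)) t := by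
  have hcomp : (fun τ => T (f τ)) = fun τ => TSpace.extIsometry T (TSpace.emb T (f τ)) := by
    ext1 τ
    rw [TSpace.extIsometry_emb]
  have hfwd (h : DifferentiableAt ℝ (fun τ => TSpace.emb T (f τ)) t) :
      HasDerivAt (fun τ => T (f τ)) (TSpace.extIsometry T
        (deriv (fun τ => TSpace.emb T (f τ)) t)) t := by
    rw [hcomp]
    exact (TSpace.extIsometry T).toContinuousLinearMap.hasFDerivAt.comp_hasDerivAt t h.hasDerivAt
  have hiff : DifferentiableAt ℝ (fun τ => TSpace.emb T (f τ)) t ↔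
      DifferentiableAt ℝ (fun τ => T (f τ)) t := by
    refine ⟨fun h => (hfwd h).differentiableAt, fun h => ?_⟩
    have h' := h.hasDerivAt
    rw [hcomp] at h'
    obtain ⟨w, _, hw⟩ := hasDerivAt_of_linearIsometry_comp _ h'
    exact hw.differentiableAt
  refine ⟨hiff, ?_⟩
  by_cases h : DifferentiableAt ℝ (fun τ => TSpace.emb T (f τ)) t
  · exact (hfwd h).deriv.symm
  · rw [deriv_zero_of_not_differentiableAt h,
      deriv_zero_of_not_differentiableAt fun h' => h (hiff.2 h')]
    exact map_zero (TSpace.extIsometry T)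

end TNorm

/-! ### Equivalence of the PDE and the PIE -/

section Equivalence

open Filter Topology

variable {a b : ℝ} {n₀ n₁ n₂ m : ℕ}

theorem satisfiesPDE_iff_satisfiesPIE {G : BoundaryParams n₀ n₁ n₂ m} {P : DynamicsParams n₀ n₁ n₂}
    {T A : L2 a b (IX n₀ n₁ n₂) →L[ℝ] L2 a b (IX n₀ n₁ n₂)}
    (hTD : ∀ x, MemX G x → T (D x) = x)
    (hA : ∀ x, MemX G x → A (D x) =ᵐ[mu a b] piFun a b P.A0 P.A1 P.A2 (xD x))
    {x0 : L2 a b (IX n₀ n₁ n₂)} (hx0 : MemX G x0) {x : ℝ → L2 a b (IX n₀ n₁ n₂)}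
    (hx : ∀ t, 0 ≤ t → MemX G (x t)) :
    SatisfiesPDE G P x x0 ↔ SatisfiesPIE T A (fun t => D (x t)) (D x0) := by
  have hloc {t : ℝ} (ht : 0 < t) : (fun τ => T (D (x τ))) =ᶠ[𝓝 t] x := by
    filter_upwards [Ioi_mem_nhds ht] with τ hτ using hTD _ (hx τ (le_of_lt hτ))
  have hd {t : ℝ} (ht : 0 < t) := TSpace.differentiableAt_emb_iff T (fun τ => D (x τ)) t
  -- The end point `t = 0`, where only one-sided information is available, is a null set.
  have hpos : ∀ᵐ t ∂(volume.restrict (Ici (0 : ℝ))), 0 < t := by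
    have h0 : ∀ᵐ t ∂(volume.restrict (Ici (0 : ℝ))), t ≠ 0 := ae_restrict_of_ae (Measure.ae_ne _ _)
    filter_upwards [h0, ae_restrict_mem measurableSet_Ici] with t h1 h2
    exact lt_of_le_of_ne h2 (Ne.symm h1)
  have hdiff {t : ℝ} (ht : 0 < t) : DifferentiableAt ℝ (fun τ => TSpace.emb T (D (x τ))) t ↔
      DifferentiableAt ℝ x t := (hd ht).1.trans (hloc ht).differentiableAt_iff
  have hderiv {t : ℝ} (ht : 0 < t) :
      TSpace.ext T (deriv (fun τ => TSpace.emb T (D (x τ))) t) = deriv x t :=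
    (hd ht).2.trans (hloc ht).deriv_eq
  constructor
  · intro h
    refine ⟨?_, congrArg D h.init, ?_⟩
    · filter_upwards [h.diff, hpos] with t h1 ht using (hdiff ht).2 h1
    · filter_upwards [h.eqn, hpos] with t h1 ht
      rw [hderiv ht]
      exact Lp.ext (h1.trans (hA _ (hx t ht.le)).symm)
  · intro h
    refine ⟨hx, ?_, ?_, ?_⟩
    · filter_upwards [h.diff, hpos] with t h1 ht using (hdiff ht).1 h1
    · rw [← hTD _ (hx 0 le_rfl), ← hTD _ hx0]
      exact congrArg T h.init
    · filter_upwards [h.eqn, hpos] with t h1 ht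
      rw [hderiv ht] at h1
      rw [h1]
      exact hA _ (hx t ht.le)

end Equivalence

end PIE

theorem mainTheorem1 {a b : ℝ} (hab : a < b) {n₀ n₁ n₂ m : ℕ}
    (G : PIE.BoundaryParams n₀ n₁ n₂ m) (P : PIE.DynamicsParams n₀ n₁ n₂)
    (hBI : PIE.MatMemLp a b 2 G.BI)
    (hA0 : PIE.MatMemLp a b ⊤ P.A0)
    (hA1 : PIE.KernelL2 a b P.A1) (hA2 : PIE.KernelL2 a b P.A2)
    (hadm : PIE.Admissible a b G) :
    ∃ T A : PIE.L2 a b (PIE.IX n₀ n₁ n₂) →L[ℝ] PIE.L2 a b (PIE.IX n₀ n₁ n₂),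
      PIE.IsPI T (PIE.G0 n₀ n₁ n₂) (PIE.G1 a b G) (PIE.G2 a b G) ∧
      PIE.IsPI A (PIE.Ahat0 P) (PIE.Ahat1 a b G P) (PIE.Ahat2 a b G P) ∧
      (PIE.MatMemLp a b ⊤ G.BI → PIE.Is3PI T ∧
        (PIE.Separable a b P.A1 → PIE.Separable a b P.A2 → PIE.Is3PI A)) ∧
      ∀ x0 : PIE.L2 a b (PIE.IX n₀ n₁ n₂), PIE.MemX G x0 →
        (∀ x : ℝ → PIE.L2 a b (PIE.IX n₀ n₁ n₂), (∀ t, 0 ≤ t → PIE.MemX G (x t)) →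
          (PIE.SatisfiesPDE G P x x0 ↔
            PIE.SatisfiesPIE T A (fun t => PIE.D (x t)) (PIE.D x0))) ∧
        (∀ xf : ℝ → PIE.L2 a b (PIE.IX n₀ n₁ n₂), PIE.SatisfiesPIE T A xf (PIE.D x0) →
          PIE.SatisfiesPDE G P (fun t => T (xf t)) x0 ∧
            ∀ t, 0 ≤ t → PIE.D (T (xf t)) = xf t) := by
  -- `R` is the map from `𝒟x` to `x_D`, and `PA` the right-hand side of the PDE in terms of `x_D`.
  have hG0 : PIE.MatMemLp a b ⊤ (PIE.G0 n₀ n₁ n₂) := PIE.MatMemLp.const _ _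
  obtain ⟨T, hT⟩ := PIE.exists_isPI hG0 (PIE.isSepKernel_G1 hab G le_rfl hBI).kernelL2
    (PIE.isSepKernel_G2 hab G le_rfl hBI).kernelL2
  obtain ⟨PA, hPA⟩ := PIE.exists_isPI hA0 hA1 hA2
  have hR1 := PIE.isSepKernel_RD1 hab G le_rfl hBI
  have hR2 := PIE.isSepKernel_RD2 hab G le_rfl hBI
  obtain ⟨R, hR⟩ := PIE.exists_isPI (PIE.MatMemLp.const (PIE.U1 n₀ n₁ n₂) ⊤)
    hR1.kernelL2 hR2.kernelL2
  have hA : PIE.IsPI (PA ∘L R) (PIE.Ahat0 P) (PIE.Ahat1 a b G P) (PIE.Ahat2 a b G P) :=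
    hPA.comp hR hA1 hA2 hR1 hR2
  have hTD : ∀ x, PIE.MemX G x → T (PIE.D x) = x := fun x hx => PIE.T_D hab hBI hadm hT hx
  have hAD : ∀ x, PIE.MemX G x →
      (PA ∘L R) (PIE.D x) =ᵐ[PIE.mu a b] PIE.piFun a b P.A0 P.A1 P.A2 (PIE.xD x) := fun x hx =>
    (hPA (R (PIE.D x))).trans (PIE.piFun_congr (PIE.RD_D_ae_eq hab hBI hadm hR hx))
  refine ⟨T, PA ∘L R, hT, hA, fun hBI' => ⟨⟨_, _, _, hG0,
    (PIE.isSepKernel_G1 hab G le_top hBI').separable,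
    (PIE.isSepKernel_G2 hab G le_top hBI').separable, hT⟩, fun h1 h2 => ⟨_, _, _,
    hA0.mul (.const (PIE.U1 n₀ n₁ n₂) ⊤),
    (PIE.isSepKernel_Ahat1 hab G P hBI' hA0 h1.isSepKernel h2.isSepKernel).separable,
    (PIE.isSepKernel_Ahat2 hab G P hBI' hA0 h1.isSepKernel h2.isSepKernel).separable, hA⟩⟩,
    fun x0 hx0 => ⟨fun x hx => PIE.satisfiesPDE_iff_satisfiesPIE hTD hAD hx0 hx,
      fun xf hxf => ?_⟩⟩
  have hmem := fun t => PIE.memX_T hab hBI hadm hT (xf t)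
  refine ⟨(PIE.satisfiesPDE_iff_satisfiesPIE hTD hAD hx0 fun t _ => (hmem t).1).2 ?_,
    fun t _ => (hmem t).2⟩
  simpa only [(hmem _).2] using hxf
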